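/- **Setting.** For each $k\in\mathbb N$ let $p=p_k\ge 2$, $L=L_k\ge 1$ and $s=s_k\ge 0$ be integers with $p_k\to\infty$ and $\log p_k/L_k\to 0$ as $k\to\infty$. For each $k$ there are $L$ tasks $$y^{(\ell)}=X^{(\ell)}\bar\beta^{(\ell)}+\varepsilon^{(\ell)}\in\mathbb R^{n_\ell},\qquad \ell=1,\dots,L,$$ where all objects, including $n_\ell$, may depend on $k$ (except $\sigma$ and the constants named below). For fixed constants $\tau_\beta,\tau_\varepsilon\ge 0$ and $\gamma_0,c_0,\kappa>0$ not depending on $k$ and $\ell$, assume: 1. (Fixed design.) $X^{(\ell)}\in\mathbb R^{n_\ell\times p}$ is deterministic, $p/n_\ell\ge\gamma_0$, $\lambda_{\max}\big(\tfrac1{n_\ell}X^{(\ell)\top}X^{(\ell)}\big)\le c_0$, and $$\frac1{p^2}\big\|(X^{(\ell)}\otimes X^{(\ell)})\operatorname{vec}(\Delta)\big\|_2^2\ \ge\ \kappa\,\|\Delta\|_F^2\quad\text{for every symmetric }\Delta\in\mathbb R^{p\times p}.$$ 2. (Random effects.) The random vectors $\bar\beta^{(1)},\dots,\bar\beta^{(L)},\varepsilon^{(1)},\dots,\varepsilon^{(L)}$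 are independent with $\mathbb E\bar\beta^{(\ell)}=0$, $\mathbb E\bar\beta^{(\ell)}\bar\beta^{(\ell)\top}=\frac1p\Omega$, $\mathbb E\varepsilon^{(\ell)}=0$, $\mathbb E\varepsilon^{(\ell)}\varepsilon^{(\ell)\top}=\sigma^2I$. The vectors $\sqrt p\,\bar\beta^{(\ell)}$ and $\varepsilon^{(\ell)}$ are sub-Gaussian with parameters $\tau_\beta$ and $\tau_\varepsilon$, where a random vector $x$ is sub-Gaussian with parameter $\tau$ if $\mathbb E\exp(t\,v^\top(x-\mathbb Ex))\le\exp(t^2\tau^2/2)$ for all $t\in\mathbb R$ and all unit vectors $v$. 3. (Sparsity.) $\Omega=\Omega_k\in\mathbb R^{p\times p}$ has at most $s$ nonzero off-diagonal entries. Let $\hat\Omega$ be a minimizer, over the cone $\mathbb S_p^+$ of positive definite matrices, of $$\tilde\Omega\ \mapsto\ \frac1L\sum_{\ell=1}^L\Big\|y^{(\ell)}y^{(\ell)\top}-\frac1pX^{(\ell)}\tilde\Omega X^{(\ell)\top}-\sigma^2I\Big\|_F^2+\tilde\lambda\sum_{i\ne j}|\tilde\Omega_{ij}|,$$ where, since $\mathbb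 S_p^+$ is open, $\hat\Omega$ is allowed to attain the infimum in the closure of $\mathbb S_p^+$. **Theorem.** There is a constant $C_0>0$, depending only on $\tau_\beta,\tau_\varepsilon,\gamma_0,c_0$, such that if $\tilde\lambda\asymp\sqrt{\log p/L}$ with a sufficiently large constant, that is, $$c_1\sqrt{\frac{\log p}{L}}\le\tilde\lambda\le c_2\sqrt{\frac{\log p}{L}}\quad\text{for all }k,\text{ with constants } c_2\ge c_1\ge C_0,$$ then $$\|\hat\Omega-\Omega\|_F=\mathcal O_P\Bigg(\sqrt{\frac{(p+s)\log p}{L}}\Bigg),$$ where $Z_k=\mathcal O_P(b_k)$ means $\sup_k\mathbb P(|Z_k|/b_k>K)\to 0$ as $K\to\infty$. -/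

import Mathlib

open MeasureTheory ProbabilityTheory Filter Topology Matrix
open scoped NNReal ENNReal Kronecker

-- From here on, `‖A‖` for a matrix `A` is its Frobenius norm.
attribute [local instance] Matrix.frobeniusNormedAddCommGroup

namespace HyperCov

noncomputable section

/-- A random vector `x` in `ℝ^d` is sub-Gaussian with parameter `τ`: for every unit vector `v` and
every real `t`, `E exp (t vᵀ(x - E x)) ≤ exp (t² τ² / 2)`, the expectation being finite. -/
def IsSubGaussianVec {S : Type*} [MeasurableSpace S] (μ : Measure S) {d : ℕ}
    (x : S → Fin d → ℝ) (τ : ℝ≥0) : Prop :=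
  ∀ v : Fin d → ℝ, v ⬝ᵥ v = 1 →
    HasSubgaussianMGF (fun ω => v ⬝ᵥ (fun i => x ω i - ∫ ω', x ω' i ∂μ)) (τ ^ 2) μ

/-- `Z_k = O_P(b_k)` (for positive `b_k`): `sup_k P(|Z_k / b_k| > K) → 0` as `K → ∞`.
The variables `Z_k` may live on different probability spaces. -/
def IsBigOP {S : ℕ → Type*} [∀ k, MeasurableSpace (S k)] (μ : ∀ k, Measure (S k))
    (Z : ∀ k, S k → ℝ) (b : ℕ → ℝ) : Prop :=
  Tendsto (fun K : ℝ => ⨆ k, μ k {ω | K < |Z k ω / b k|}) atTop (𝓝 0)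

/-- The sample covariance matrix `n⁻¹ Xᵀ X` of an `n × p` design. -/
def sampleCov {n p : ℕ} (X : Matrix (Fin n) (Fin p) ℝ) : Matrix (Fin p) (Fin p) ℝ :=
  (1 / (n : ℝ)) • (Xᵀ * X)

/-- The response `y = X β + ε` of one task. -/
def response {n p : ℕ} (X : Matrix (Fin n) (Fin p) ℝ) (β : Fin p → ℝ) (ε : Fin n → ℝ) :
    Fin n → ℝ :=
  X *ᵥ β + ε

/-- The positions of the nonzero off-diagonal entries of a matrix. -/
def offDiagSupport {p : ℕ} (A : Matrix (Fin p) (Fin p) ℝ) : Set (Fin p × Fin p) :=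
  {ij | A ij.1 ij.2 ≠ 0 ∧ ij.1 ≠ ij.2}

/-- The `L₁`-penalized least squares objective
`L⁻¹ ∑_ℓ ‖y_ℓ y_ℓᵀ - p⁻¹ X_ℓ W X_ℓᵀ - σ² I‖_F² + lam ∑_{i ≠ j} |W_ij|`. -/
def objective {p L : ℕ} {n : Fin L → ℕ} (X : ∀ ℓ, Matrix (Fin (n ℓ)) (Fin p) ℝ)
    (y : ∀ ℓ, Fin (n ℓ) → ℝ) (σ lam : ℝ) (W : Matrix (Fin p) (Fin p) ℝ) : ℝ :=
  (1 / (L : ℝ)) * ∑ ℓ, ‖vecMulVec (y ℓ) (y ℓ) - (1 / (p : ℝ)) • (X ℓ * W * (X ℓ)ᵀ)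
      - σ ^ 2 • (1 : Matrix (Fin (n ℓ)) (Fin (n ℓ)) ℝ)‖ ^ 2
    + lam * ∑ i, ∑ j ∈ Finset.univ.erase i, |W i j|

/-- `W` attains the infimum of the objective over the positive definite matrices. Since that cone
is open, the infimum need not be attained inside it, so `W` is allowed to lie in its closure, the
positive semidefinite matrices; a positive definite `W` satisfies this exactly if it is a minimizer
of the objective over the positive definite matrices. -/
def IsPenalizedMinimizer {p L : ℕ} {n : Fin L → ℕ} (X : ∀ ℓ, Matrix (Fin (n ℓ)) (Fin p) ℝ)
    (y : ∀ ℓ, Fin (n ℓ) → ℝ) (σ lam : ℝ) (W : Matrix (Fin p) (Fin p) ℝ) : Prop :=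
  W.PosSemidef ∧ ∀ V : Matrix (Fin p) (Fin p) ℝ, V.PosDef →
    objective X y σ lam W ≤ objective X y σ lam V

/-- Deterministic designs `X_ℓ`, `ℓ < L`, in dimension `p`: the ratios `p / n_ℓ` are at least
`γ₀`, the largest eigenvalues of the sample covariances are at most `c₀`, and
`p⁻² ‖(X_ℓ ⊗ X_ℓ) vec Δ‖₂² ≥ κ ‖Δ‖_F²` for all symmetric `Δ`. -/
structure IsFixedDesign {p L : ℕ} {n : Fin L → ℕ} (X : ∀ ℓ, Matrix (Fin (n ℓ)) (Fin p) ℝ)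
    (γ₀ c₀ κ : ℝ) : Prop where
  ratio_lower : ∀ ℓ, γ₀ ≤ (p : ℝ) / (n ℓ : ℝ)
  cov_upper : ∀ ℓ, (c₀ • (1 : Matrix (Fin p) (Fin p) ℝ) - sampleCov (X ℓ)).PosSemidef
  restricted_eigenvalue : ∀ ℓ, ∀ Δ : Matrix (Fin p) (Fin p) ℝ, Δ.IsSymm →
    κ * ‖Δ‖ ^ 2 ≤ (1 / (p : ℝ) ^ 2) * ‖WithLp.toLp 2 ((X ℓ ⊗ₖ X ℓ) *ᵥ vec Δ)‖ ^ 2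

/-- The random coefficients `β_ℓ` and noises `ε_ℓ`, `ℓ < L`: the tasks are independent,
`β_ℓ` and `ε_ℓ` are independent of each other, `E β_ℓ = 0`, `E β_ℓ β_ℓᵀ = p⁻¹ Ω`, `E ε_ℓ = 0`,
`E ε_ℓ ε_ℓᵀ = σ² I`, and `√p β_ℓ`, `ε_ℓ` are sub-Gaussian with parameters `τβ`, `τε`. -/
structure IsRandomEffects {p L : ℕ} {n : Fin L → ℕ} {S : Type*} [MeasurableSpace S]
    (μ : Measure S) (β : Fin L → S → Fin p → ℝ) (ε : ∀ ℓ, S → Fin (n ℓ) → ℝ)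
    (Ω : Matrix (Fin p) (Fin p) ℝ) (σ : ℝ) (τβ τε : ℝ≥0) : Prop where
  measurable_coef : ∀ ℓ, Measurable (β ℓ)
  measurable_noise : ∀ ℓ, Measurable (ε ℓ)
  indep_tasks : iIndepFun (fun ℓ ω => (β ℓ ω, ε ℓ ω)) μ
  indep_coef_noise : ∀ ℓ, IndepFun (β ℓ) (ε ℓ) μ
  mean_coef : ∀ ℓ i, ∫ ω, β ℓ ω i ∂μ = 0
  mean_noise : ∀ ℓ i, ∫ ω, ε ℓ ω i ∂μ = 0
  cov_coef : ∀ ℓ i j, ∫ ω, β ℓ ω i * β ℓ ω j ∂μ = Ω i j / p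
  cov_noise : ∀ ℓ i j, ∫ ω, ε ℓ ω i * ε ℓ ω j ∂μ = if i = j then σ ^ 2 else 0
  subGaussian_coef : ∀ ℓ, IsSubGaussianVec μ (fun ω => √(p : ℝ) • β ℓ ω) τβ
  subGaussian_noise : ∀ ℓ, IsSubGaussianVec μ (ε ℓ) τε

end

end HyperCov

/-! The loss is exactly quadratic in the candidate matrix. Expanding it at Ω with Δ = Ω̂ - Ω gives a
curvature term, at least κ‖Δ‖² by the restricted eigenvalue condition, and a linear term with
coefficients G = (2/L) ∑ score. Since Ω̂ does at least as well as Ω, κ‖Δ‖² ≤ ∑ |G_ij| |Δ_ij| + λ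
(‖Ω‖₁ - ‖Ω̂‖₁), with off-diagonal ℓ₁ norms (`IsPenalizedMinimizer.basic_inequality`). If all |G_ij|
≤ λ, the entries where Ω vanishes off the diagonal cancel against the penalty. At most p + s
positions remain, and Cauchy–Schwarz gives κ‖Δ‖ ≤ 2λ√(p + s)
(`IsPenalizedMinimizer.norm_sub_le_of_score_le`). No cone condition on Δ is needed, because the
curvature bound holds for all symmetric matrices.

It remains to control max |G_ij|. A score entry is a centred product of two linear forms in the
response. These are sub-Gaussian with a proxy independent of p, n and L, so their product has an
exponential moment. Bernstein's inequality over the L independent tasks and a union bound over p²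
entries give |G_ij| ≤ λ outside an event of probability 2/p²
(`IsRandomEffects.measure_score_gt_le`). This bound requires log p ≤ L, hence covers only large k;
the finitely many other indices use the cruder `IsPenalizedMinimizer.norm_sub_le`. -/

namespace HyperCov

/-! ### Exponential moments of products and Bernstein's inequality. -/

section Concentration

variable {S : Type*} [MeasurableSpace S] {μ : Measure S}

lemma lintegral_exp_mul_gaussianReal (x : ℝ) :
    ∫⁻ g, ENNReal.ofReal (Real.exp (x * g)) ∂(gaussianReal 0 1)
      = ENNReal.ofReal (Real.exp (x ^ 2 / 2)) := by
  rw [← ofReal_integral_eq_lintegral_ofReal (integrable_exp_mul_gaussianReal x)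
    (ae_of_all _ fun _ => (Real.exp_pos _).le)]
  have h := congrFun (mgf_fun_id_gaussianReal (μ := 0) (v := 1)) x
  simp only [mgf, zero_mul, zero_add, NNReal.coe_one, one_mul] at h
  rw [h]

/-- For a standard Gaussian, E exp(a g²) = (1 - 2a)^(-1/2); a = 3/8 is the value making this 2. -/
lemma lintegral_exp_sq_gaussianReal :
    ∫⁻ g, ENNReal.ofReal (Real.exp (3 / 8 * g ^ 2)) ∂(gaussianReal 0 1) = 2 := by
  have hint : Integrable (fun x : ℝ => (√(2 * Real.pi))⁻¹ * Real.exp (-(1 / 8) * x ^ 2)) :=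
    (integrable_exp_neg_mul_sq (by norm_num)).const_mul _
  have key : ∀ x : ℝ, gaussianPDF 0 1 x * ENNReal.ofReal (Real.exp (3 / 8 * x ^ 2))
      = ENNReal.ofReal ((√(2 * Real.pi))⁻¹ * Real.exp (-(1 / 8) * x ^ 2)) := by
    intro x
    rw [gaussianPDF, ← ENNReal.ofReal_mul (gaussianPDFReal_nonneg _ _ _), gaussianPDFReal,
      mul_assoc, ← Real.exp_add]
    congr 3
    · simp
    · simp; ring
  rw [gaussianReal_of_var_ne_zero _ one_ne_zero,
    lintegral_withDensity_eq_lintegral_mul _ (measurable_gaussianPDF _ _) (by fun_prop)]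
  simp only [Pi.mul_apply, key]
  rw [← ofReal_integral_eq_lintegral_ofReal hint (ae_of_all _ fun _ => by positivity),
    integral_const_mul, integral_gaussian]
  have : (√(2 * Real.pi))⁻¹ * √(Real.pi / (1 / 8)) = 2 := by
    have h : Real.pi / (1 / 8) = 2 ^ 2 * (2 * Real.pi) := by ring
    rw [h, Real.sqrt_mul (x := 2 ^ 2) (by norm_num), Real.sqrt_sq (by norm_num)]
    have : √(2 * Real.pi) ≠ 0 := by positivity
    field_simp
  rw [this]; simp

/-- A sub-Gaussian variable has a square-exponential moment. -/
lemma lintegral_exp_sq_le [SFinite μ] {z : S → ℝ} {V : ℝ≥0} (hV : 0 < V)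
    (hz : HasSubgaussianMGF z V μ) :
    ∫⁻ ω, ENNReal.ofReal (Real.exp (3 / (8 * V) * z ω ^ 2)) ∂μ ≤ 2 := by
  have hV' : (0 : ℝ) < V := hV
  -- An auxiliary Gaussian g linearizes the square: exp(s²z²/2) = E_g exp(s z g), with s²/2 =
  -- 3/(8V). After Tonelli, the sub-Gaussian bound at s g leaves exp(V s² g²/2) = exp(3g²/8).
  set s : ℝ := √(3 / (4 * V)) with hs
  have hs2 : s ^ 2 = 3 / (4 * V) := Real.sq_sqrt (by positivity)
  have hm : AEMeasurable z μ := hz.aemeasurable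
  calc ∫⁻ ω, ENNReal.ofReal (Real.exp (3 / (8 * V) * z ω ^ 2)) ∂μ
      = ∫⁻ ω, ∫⁻ g, ENNReal.ofReal (Real.exp (s * z ω * g)) ∂(gaussianReal 0 1) ∂μ := by
        refine lintegral_congr fun ω => ?_
        rw [lintegral_exp_mul_gaussianReal, mul_pow, hs2]
        congr 2; field_simp; ring
    _ = ∫⁻ g, ∫⁻ ω, ENNReal.ofReal (Real.exp (s * z ω * g)) ∂μ ∂(gaussianReal 0 1) := by
        rw [lintegral_lintegral_swap]
        have : AEMeasurable (fun q : S × ℝ => z q.1) (μ.prod (gaussianReal 0 1)) :=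
          hm.comp_quasiMeasurePreserving Measure.quasiMeasurePreserving_fst
        simp only [Function.uncurry_def]
        fun_prop
    _ ≤ ∫⁻ g, ENNReal.ofReal (Real.exp (3 / 8 * g ^ 2)) ∂(gaussianReal 0 1) := by
        refine lintegral_mono fun g => ?_
        have h := hz.mgf_le (s * g)
        have he : ∀ ω, s * z ω * g = s * g * z ω := fun ω => by ring
        simp only [he]
        rw [← ofReal_integral_eq_lintegral_ofReal (hz.integrable_exp_mul _)
          (ae_of_all _ fun _ => (Real.exp_pos _).le)]
        refine ENNReal.ofReal_le_ofReal (h.trans (le_of_eq ?_))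
        rw [mul_pow, hs2]
        congr 1; field_simp; ring
    _ = 2 := lintegral_exp_sq_gaussianReal

lemma integrable_of_lintegral_ofReal_le {f : S → ℝ} (hf : AEMeasurable f μ) (h0 : ∀ ω, 0 ≤ f ω)
    {M : ℝ} (h : ∫⁻ ω, ENNReal.ofReal (f ω) ∂μ ≤ ENNReal.ofReal M) (hM : 0 ≤ M) :
    Integrable f μ ∧ ∫ ω, f ω ∂μ ≤ M := by
  have hi : Integrable f μ := by
    refine ⟨hf.aestronglyMeasurable, ?_⟩
    rw [hasFiniteIntegral_iff_ofReal (ae_of_all _ h0)]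
    exact h.trans_lt ENNReal.ofReal_lt_top
  refine ⟨hi, ?_⟩
  rw [← ofReal_integral_eq_lintegral_ofReal hi (ae_of_all _ h0)] at h
  exact (ENNReal.ofReal_le_ofReal_iff hM).1 h

/-- The product of two sub-Gaussian variables has an exponential moment. -/
lemma integral_exp_abs_mul_le [SFinite μ] {z z' : S → ℝ} {V : ℝ≥0} (hV : 0 < V)
    (hz : HasSubgaussianMGF z V μ) (hz' : HasSubgaussianMGF z' V μ) :
    Integrable (fun ω => Real.exp (3 / (8 * V) * |z ω * z' ω|)) μ ∧
      ∫ ω, Real.exp (3 / (8 * V) * |z ω * z' ω|) ∂μ ≤ 2 := by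
  have hV' : (0 : ℝ) < V := hV
  have sq : ∀ {x : S → ℝ}, HasSubgaussianMGF x V μ →
      Integrable (fun ω => Real.exp (3 / (8 * V) * x ω ^ 2)) μ ∧
        ∫ ω, Real.exp (3 / (8 * V) * x ω ^ 2) ∂μ ≤ 2 := fun {x} hx => by
    have hm : AEMeasurable x μ := hx.aemeasurable
    exact integrable_of_lintegral_ofReal_le (by fun_prop) (fun _ => (Real.exp_pos _).le)
      (by simpa using lintegral_exp_sq_le hV hx) (by norm_num)
  obtain ⟨i1, b1⟩ := sq hz
  obtain ⟨i2, b2⟩ := sq hz'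
  have hm : AEMeasurable z μ := hz.aemeasurable
  have hm' : AEMeasurable z' μ := hz'.aemeasurable
  -- The arithmetic–geometric mean inequality is used twice: on |z z'|, then on the two resulting
  -- exponentials.
  have hle : ∀ ω, Real.exp (3 / (8 * V) * |z ω * z' ω|) ≤
      (1 / 2) * (Real.exp (3 / (8 * V) * z ω ^ 2) + Real.exp (3 / (8 * V) * z' ω ^ 2)) := by
    intro ω
    set θ : ℝ := 3 / (8 * V) with hθ
    have hθ0 : 0 ≤ θ := by positivity
    have h1 : θ * |z ω * z' ω| ≤ θ * z ω ^ 2 / 2 + θ * z' ω ^ 2 / 2 := by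
      have : |z ω * z' ω| ≤ z ω ^ 2 / 2 + z' ω ^ 2 / 2 := by
        rw [abs_mul]
        nlinarith [sq_nonneg (|z ω| - |z' ω|), sq_abs (z ω), sq_abs (z' ω)]
      nlinarith [mul_le_mul_of_nonneg_left this hθ0]
    refine (Real.exp_le_exp.2 h1).trans ?_
    rw [Real.exp_add]
    have e1 : Real.exp (θ * z ω ^ 2) = Real.exp (θ * z ω ^ 2 / 2) ^ 2 := by
      rw [← Real.exp_nat_mul]; congr 1; push_cast; ring
    have e2 : Real.exp (θ * z' ω ^ 2) = Real.exp (θ * z' ω ^ 2 / 2) ^ 2 := by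
      rw [← Real.exp_nat_mul]; congr 1; push_cast; ring
    rw [e1, e2]
    nlinarith [sq_nonneg (Real.exp (θ * z ω ^ 2 / 2) - Real.exp (θ * z' ω ^ 2 / 2))]
  have hi : Integrable (fun ω => Real.exp (3 / (8 * V) * |z ω * z' ω|)) μ := by
    refine ((i1.add i2).const_mul (1 / 2)).mono' ?_ (ae_of_all _ fun ω => ?_)
    · exact AEMeasurable.aestronglyMeasurable (by fun_prop)
    · rw [Real.norm_of_nonneg (Real.exp_pos _).le]; exact hle ω
  refine ⟨hi, (integral_mono hi ((i1.add i2).const_mul (1 / 2)) hle).trans ?_⟩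
  simp only [Pi.add_apply]
  rw [integral_const_mul, integral_add i1 i2]
  linarith

lemma exp_le_one_add_add_sq_mul_exp_abs (x : ℝ) :
    Real.exp x ≤ 1 + x + x ^ 2 * Real.exp |x| := by
  have h := Complex.norm_exp_sub_sum_le_norm_mul_exp (x : ℂ) 2
  have h1 : Complex.exp x - ∑ m ∈ Finset.range 2, (x : ℂ) ^ m / m.factorial
      = ((Real.exp x - (1 + x) : ℝ) : ℂ) := by
    simp [Finset.sum_range_succ]
  rw [h1, Complex.norm_real, Complex.norm_real, Real.norm_eq_abs, Real.norm_eq_abs, sq_abs] at h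
  linarith [le_abs_self (Real.exp x - (1 + x))]

lemma sq_le_two_mul_exp {x : ℝ} (hx : 0 ≤ x) : x ^ 2 ≤ 2 * Real.exp x := by
  nlinarith [Real.quadratic_le_exp_of_nonneg hx]

lemma integrable_of_integrable_exp_abs {w : S → ℝ} (hw : AEMeasurable w μ) {θ : ℝ} (hθ : 0 < θ)
    (hi : Integrable (fun ω => Real.exp (θ * |w ω|)) μ) : Integrable w μ := by
  refine (hi.const_mul (1 / θ)).mono' hw.aestronglyMeasurable (ae_of_all _ fun ω => ?_)
  have h := Real.add_one_le_exp (θ * |w ω|)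
  rw [Real.norm_eq_abs, one_div, ← div_eq_inv_mul, le_div_iff₀ hθ]
  linarith

lemma integrable_exp_mul_of_abs_le {w : S → ℝ} (hw : AEMeasurable w μ) {θ s : ℝ} (hs : |s| ≤ θ)
    (hi : Integrable (fun ω => Real.exp (θ * |w ω|)) μ) :
    Integrable (fun ω => Real.exp (s * w ω)) μ := by
  refine hi.mono' (AEMeasurable.aestronglyMeasurable (by fun_prop)) (ae_of_all _ fun ω => ?_)
  rw [Real.norm_of_nonneg (Real.exp_pos _).le, Real.exp_le_exp]
  exact (le_abs_self _).trans
    ((abs_mul s (w ω)).le.trans (mul_le_mul_of_nonneg_right hs (abs_nonneg _)))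

/-- A variable with an exponential moment has a sub-Gaussian moment generating function near `0`. -/
lemma mgf_le_of_integral_exp_abs_le [IsProbabilityMeasure μ] {w : S → ℝ} (hw : AEMeasurable w μ)
    {θ s : ℝ} (hθ : 0 < θ) (hs : |s| ≤ θ / 2)
    (hi : Integrable (fun ω => Real.exp (θ * |w ω|)) μ)
    (hb : ∫ ω, Real.exp (θ * |w ω|) ∂μ ≤ 2) :
    mgf w μ s ≤ Real.exp (s * (∫ ω, w ω ∂μ) + 16 / θ ^ 2 * s ^ 2) := by
  have hiw := integrable_of_integrable_exp_abs hw hθ hi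
  -- Of the available exponent θ|w|, one half dominates exp|s w| and the other half absorbs w².
  have hpt : ∀ ω, Real.exp (s * w ω)
      ≤ 1 + s * w ω + s ^ 2 * (8 / θ ^ 2) * Real.exp (θ * |w ω|) := by
    intro ω
    refine (exp_le_one_add_add_sq_mul_exp_abs _).trans ?_
    have h1 : |s * w ω| ≤ θ / 2 * |w ω| := by
      rw [abs_mul]; exact mul_le_mul_of_nonneg_right hs (abs_nonneg _)
    have h2 := sq_le_two_mul_exp (x := θ / 2 * |w ω|) (by positivity)
    have h3 : Real.exp (θ * |w ω|) = Real.exp (θ / 2 * |w ω|) * Real.exp (θ / 2 * |w ω|) := by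
      rw [← Real.exp_add]; congr 1; ring
    have h4 : w ω ^ 2 ≤ 8 / θ ^ 2 * Real.exp (θ / 2 * |w ω|) := by
      rw [div_mul_eq_mul_div, le_div_iff₀ (by positivity)]
      rw [mul_pow, sq_abs] at h2
      nlinarith
    rw [h3]
    have h5 : (s * w ω) ^ 2 * Real.exp |s * w ω| ≤
        s ^ 2 * (8 / θ ^ 2 * Real.exp (θ / 2 * |w ω|)) * Real.exp (θ / 2 * |w ω|) := by
      rw [mul_pow]
      gcongr
    linarith
  have hi1 : Integrable (fun ω => 1 + s * w ω) μ := (integrable_const _).add (hiw.const_mul s)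
  have hi2 := hi.const_mul (s ^ 2 * (8 / θ ^ 2))
  have h := integral_mono (integrable_exp_mul_of_abs_le hw (hs.trans (by linarith)) hi)
    (hi1.add hi2) hpt
  simp only [Pi.add_apply] at h
  rw [integral_add hi1 hi2, integral_add (integrable_const _) (hiw.const_mul s),
    integral_const_mul, integral_const_mul] at h
  simp only [integral_const, probReal_univ, smul_eq_mul, mul_one] at h
  have h6 : s ^ 2 * (8 / θ ^ 2) * ∫ ω, Real.exp (θ * |w ω|) ∂μ ≤ 16 / θ ^ 2 * s ^ 2 := by
    calc _ ≤ s ^ 2 * (8 / θ ^ 2) * 2 := by gcongr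
      _ = _ := by ring
  have h7 := Real.add_one_le_exp (s * (∫ ω, w ω ∂μ) + 16 / θ ^ 2 * s ^ 2)
  rw [mgf]
  linarith

/-- One-sided Bernstein inequality for independent variables with exponential moments. -/
lemma measureReal_sum_sub_integral_ge_le [IsProbabilityMeasure μ] {ι : Type*} [Fintype ι]
    {w : ι → S → ℝ} (hw : ∀ i, Measurable (w i)) (hind : iIndepFun w μ) {θ t : ℝ} (hθ : 0 < θ)
    (ht : 0 ≤ t) (htθ : t ≤ 16 / θ)
    (hi : ∀ i, Integrable (fun ω => Real.exp (θ * |w i ω|)) μ)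
    (hb : ∀ i, ∫ ω, Real.exp (θ * |w i ω|) ∂μ ≤ 2) :
    μ.real {ω | Fintype.card ι * t ≤ ∑ i, (w i ω - ∫ ω', w i ω' ∂μ)}
      ≤ Real.exp (-(Fintype.card ι * t ^ 2 * θ ^ 2 / 64)) := by
  -- This s minimizes the Chernoff exponent -s t + 16 s²/θ², with minimum -t²θ²/64. The condition t
  -- ≤ 16/θ says exactly that s ≤ θ/2.
  set s : ℝ := t * θ ^ 2 / 32 with hs
  have hs0 : 0 ≤ s := by positivity
  have hsθ : |s| ≤ θ / 2 := by
    rw [abs_of_nonneg hs0, hs]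
    rw [le_div_iff₀ hθ] at htθ
    nlinarith
  have hint := hind.integrable_exp_mul_sum hw (s := Finset.univ) (t := s) fun i _ =>
    integrable_exp_mul_of_abs_le (hw i).aemeasurable (hsθ.trans (by linarith)) (hi i)
  have h := measure_ge_le_exp_mul_mgf
    (Fintype.card ι * t + ∑ i, ∫ ω', w i ω' ∂μ) hs0 hint
  rw [hind.mgf_sum hw] at h
  have hset : {ω | Fintype.card ι * t ≤ ∑ i, (w i ω - ∫ ω', w i ω' ∂μ)}
      = {ω | Fintype.card ι * t + ∑ i, ∫ ω', w i ω' ∂μ ≤ (∑ i, w i) ω} := by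
    ext ω
    simp only [Set.mem_ofPred_eq, Finset.sum_sub_distrib, Finset.sum_apply, le_sub_iff_add_le]
  rw [hset]
  refine h.trans ?_
  have hprod : ∏ i, mgf (w i) μ s
      ≤ ∏ i, Real.exp (s * (∫ ω, w i ω ∂μ) + 16 / θ ^ 2 * s ^ 2) :=
    Finset.prod_le_prod (fun i _ => mgf_nonneg) fun i _ =>
      mgf_le_of_integral_exp_abs_le (hw i).aemeasurable hθ hsθ (hi i) (hb i)
  refine (mul_le_mul_of_nonneg_left hprod (Real.exp_pos _).le).trans (le_of_eq ?_)
  rw [← Real.exp_sum, ← Real.exp_add, Finset.sum_add_distrib, ← Finset.mul_sum]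
  congr 1
  simp only [Finset.sum_const, Finset.card_univ, nsmul_eq_mul]
  rw [hs]
  field_simp
  ring

/-- Bernstein inequality for independent variables with exponential moments. -/
lemma measureReal_abs_sum_sub_integral_ge_le [IsProbabilityMeasure μ] {ι : Type*} [Fintype ι]
    {w : ι → S → ℝ} (hw : ∀ i, Measurable (w i)) (hind : iIndepFun w μ) {θ t : ℝ} (hθ : 0 < θ)
    (ht : 0 ≤ t) (htθ : t ≤ 16 / θ)
    (hi : ∀ i, Integrable (fun ω => Real.exp (θ * |w i ω|)) μ)
    (hb : ∀ i, ∫ ω, Real.exp (θ * |w i ω|) ∂μ ≤ 2) :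
    μ.real {ω | Fintype.card ι * t ≤ |∑ i, (w i ω - ∫ ω', w i ω' ∂μ)|}
      ≤ 2 * Real.exp (-(Fintype.card ι * t ^ 2 * θ ^ 2 / 64)) := by
  have h1 := measureReal_sum_sub_integral_ge_le hw hind hθ ht htθ hi hb
  have h2 := measureReal_sum_sub_integral_ge_le (w := fun i ω => - w i ω) (fun i => (hw i).neg)
    (hind.comp (fun _ x => -x) fun _ => measurable_neg) hθ ht htθ
    (by simpa only [abs_neg] using hi) (by simpa only [abs_neg] using hb)
  have hsub : {ω | Fintype.card ι * t ≤ |∑ i, (w i ω - ∫ ω', w i ω' ∂μ)|} ⊆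
      {ω | Fintype.card ι * t ≤ ∑ i, (w i ω - ∫ ω', w i ω' ∂μ)} ∪
      {ω | Fintype.card ι * t ≤ ∑ i, (- w i ω - ∫ ω', - w i ω' ∂μ)} := by
    intro ω hω
    rcases le_abs.1 (Set.mem_ofPred_eq ▸ hω) with h | h
    · exact Or.inl h
    · refine Or.inr ?_
      simp only [Set.mem_ofPred_eq, integral_neg]
      refine h.trans (le_of_eq ?_)
      rw [← Finset.sum_neg_distrib]
      exact Finset.sum_congr rfl fun i _ => by ring
  refine (measureReal_mono hsub).trans ((measureReal_union_le _ _).trans ?_)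
  linarith

end Concentration

end HyperCov

namespace HyperCov

/-! ### Linear forms in sub-Gaussian vectors. -/

section Moments

variable {S : Type*} [MeasurableSpace S] {μ : Measure S}

lemma _root_.ProbabilityTheory.HasSubgaussianMGF.mono {z : S → ℝ} {c d : ℝ≥0}
    (hz : HasSubgaussianMGF z c μ) (hcd : c ≤ d) : HasSubgaussianMGF z d μ where
  integrable_exp_mul := hz.integrable_exp_mul
  mgf_le t := (hz.mgf_le t).trans (Real.exp_le_exp.2 (by
    have : (c : ℝ) ≤ d := hcd
    gcongr))

lemma IsSubGaussianVec.hasSubgaussianMGF_dotProduct [IsProbabilityMeasure μ] {d : ℕ}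
    {x : S → Fin d → ℝ} {τ V : ℝ≥0} (hx : IsSubGaussianVec μ x τ)
    (h0 : ∀ i, ∫ ω, x ω i ∂μ = 0) (v : Fin d → ℝ) (hV : v ⬝ᵥ v * τ ^ 2 ≤ V) :
    HasSubgaussianMGF (fun ω => v ⬝ᵥ x ω) V μ := by
  by_cases hv : v = 0
  · subst hv
    simpa using (HasSubgaussianMGF.fun_zero (μ := μ)).mono (zero_le (a := V))
  have hpos : 0 < v ⬝ᵥ v :=
    lt_of_le_of_ne (by simpa using dotProduct_star_self_nonneg v)
      (Ne.symm (mt dotProduct_self_eq_zero.1 hv))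
  set r : ℝ := √(v ⬝ᵥ v) with hr
  have hr2 : r ^ 2 = v ⬝ᵥ v := Real.sq_sqrt hpos.le
  have hr0 : r ≠ 0 := (Real.sqrt_pos.2 hpos).ne'
  have h1 := (hx (r⁻¹ • v) (by
    rw [smul_dotProduct, dotProduct_smul, smul_eq_mul, smul_eq_mul, ← hr2]
    field_simp)).const_mul r
  have h2 : (fun ω => r * ((r⁻¹ • v) ⬝ᵥ fun i => x ω i - ∫ ω', x ω' i ∂μ))
      = fun ω => v ⬝ᵥ x ω := by
    funext ω
    simp only [h0, sub_zero, smul_dotProduct, smul_eq_mul]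
    rw [← mul_assoc, mul_inv_cancel₀ hr0, one_mul]
  rw [h2] at h1
  refine h1.mono ?_
  rw [← NNReal.coe_le_coe]
  change r ^ 2 * (τ : ℝ) ^ 2 ≤ V
  rwa [hr2]

/-- Expectation of the product of two linear forms in random vectors. -/
lemma integral_dotProduct_mul_dotProduct {a b : Type*} [Fintype a] [Fintype b]
    {x : S → a → ℝ} {x' : S → b → ℝ} (hx : ∀ i, MemLp (fun ω => x ω i) 2 μ)
    (hx' : ∀ j, MemLp (fun ω => x' ω j) 2 μ) {M : Matrix a b ℝ}
    (hM : ∀ i j, ∫ ω, x ω i * x' ω j ∂μ = M i j) (u : a → ℝ) (v : b → ℝ) :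
    ∫ ω, (u ⬝ᵥ x ω) * (v ⬝ᵥ x' ω) ∂μ = u ⬝ᵥ (M *ᵥ v) := by
  have hi : ∀ i j, Integrable (fun ω => u i * v j * (x ω i * x' ω j)) μ := fun i j =>
    ((hx i).integrable_mul (hx' j)).const_mul _
  have h : ∀ ω, (u ⬝ᵥ x ω) * (v ⬝ᵥ x' ω) = ∑ i, ∑ j, u i * v j * (x ω i * x' ω j) := by
    intro ω
    simp only [dotProduct, Finset.sum_mul_sum]
    exact Finset.sum_congr rfl fun i _ => Finset.sum_congr rfl fun j _ => by ring
  simp only [h]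
  rw [integral_finsetSum _ fun i _ => integrable_finsetSum _ fun j _ => hi i j]
  simp only [dotProduct, mulVec, Finset.mul_sum]
  refine Finset.sum_congr rfl fun i _ => ?_
  rw [integral_finsetSum _ fun j _ => hi i j]
  refine Finset.sum_congr rfl fun j _ => ?_
  rw [integral_const_mul, hM]
  ring

lemma memLp_dotProduct {a : Type*} [Fintype a] {x : S → a → ℝ}
    (hx : ∀ i, MemLp (fun ω => x ω i) 2 μ) (u : a → ℝ) : MemLp (fun ω => u ⬝ᵥ x ω) 2 μ := by
  simp only [dotProduct]
  exact memLp_finsetSum _ fun i _ => (hx i).const_mul _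

lemma IsSubGaussianVec.memLp [IsProbabilityMeasure μ] {d : ℕ} {x : S → Fin d → ℝ} {τ : ℝ≥0}
    (hx : IsSubGaussianVec μ x τ) (h0 : ∀ i, ∫ ω, x ω i ∂μ = 0) (i : Fin d) :
    MemLp (fun ω => x ω i) 2 μ := by
  have h := (hx.hasSubgaussianMGF_dotProduct h0 (Pi.single i 1) (V := τ ^ 2) (by simp)).memLp 2
  simpa using h

end Moments

/-! ### Operator norm bounds for the design. -/

section Design

/-- The operator norm of the transpose is bounded by that of the matrix. -/
lemma transpose_mulVec_dotProduct_self_le {m d : Type*} [Fintype m] [Fintype d]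
    {X : Matrix m d ℝ} {C : ℝ} (hC : 0 ≤ C) (hX : ∀ a, (X *ᵥ a) ⬝ᵥ (X *ᵥ a) ≤ C * (a ⬝ᵥ a))
    (u : m → ℝ) : (Xᵀ *ᵥ u) ⬝ᵥ (Xᵀ *ᵥ u) ≤ C * (u ⬝ᵥ u) := by
  -- With a = Xᵀu, ‖a‖² = ⟨u, Xa⟩, so Cauchy–Schwarz gives ‖a‖⁴ ≤ C‖u‖²‖a‖², and one factor ‖a‖² is
  -- divided out.
  set a := Xᵀ *ᵥ u with ha
  have h1 : a ⬝ᵥ a = u ⬝ᵥ (X *ᵥ a) := by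
    rw [dotProduct_mulVec u, ← mulVec_transpose, ← ha]
  have h2 : (u ⬝ᵥ (X *ᵥ a)) ^ 2 ≤ (u ⬝ᵥ u) * ((X *ᵥ a) ⬝ᵥ (X *ᵥ a)) := by
    have := Finset.sum_mul_sq_le_sq_mul_sq Finset.univ u (X *ᵥ a)
    simpa only [dotProduct, ← sq] using this
  have ha0 : 0 ≤ a ⬝ᵥ a := by simpa using dotProduct_star_self_nonneg a
  have hu0 : 0 ≤ u ⬝ᵥ u := by simpa using dotProduct_star_self_nonneg u
  rcases ha0.eq_or_lt with h0 | h0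
  · rw [← h0]; positivity
  · have h3 := h2.trans (mul_le_mul_of_nonneg_left (hX a) hu0)
    rw [← h1, sq] at h3
    nlinarith

variable {p L : ℕ} {n : Fin L → ℕ} {X : ∀ ℓ, Matrix (Fin (n ℓ)) (Fin p) ℝ} {γ₀ c₀ κ : ℝ}

lemma IsFixedDesign.natCast_pos (hX : IsFixedDesign X γ₀ c₀ κ) (hγ : 0 < γ₀) (ℓ : Fin L) :
    (0 : ℝ) < n ℓ := by
  have h := hX.ratio_lower ℓ
  -- Division by zero returns 0, so n = 0 would contradict γ₀ ≤ p/n.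
  rcases (Nat.cast_nonneg (α := ℝ) (n ℓ)).eq_or_lt with h0 | h0
  · rw [← h0, div_zero] at h; linarith
  · exact h0

lemma IsFixedDesign.natCast_le (hX : IsFixedDesign X γ₀ c₀ κ) (hγ : 0 < γ₀) (ℓ : Fin L) :
    (n ℓ : ℝ) ≤ p / γ₀ := by
  have h := hX.ratio_lower ℓ
  rw [le_div_iff₀ (hX.natCast_pos hγ ℓ)] at h
  rw [le_div_iff₀ hγ]
  linarith

lemma IsFixedDesign.mulVec_dotProduct_self_le (hX : IsFixedDesign X γ₀ c₀ κ) (hγ : 0 < γ₀)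
    (hc : 0 < c₀) (ℓ : Fin L) (a : Fin p → ℝ) :
    (X ℓ *ᵥ a) ⬝ᵥ (X ℓ *ᵥ a) ≤ c₀ / γ₀ * p * (a ⬝ᵥ a) := by
  have h := (hX.cov_upper ℓ).dotProduct_mulVec_nonneg a
  have hn := hX.natCast_pos hγ ℓ
  have e : (X ℓ *ᵥ a) ⬝ᵥ (X ℓ *ᵥ a) = a ⬝ᵥ (((X ℓ)ᵀ * X ℓ) *ᵥ a) := by
    rw [← mulVec_mulVec, dotProduct_mulVec a, ← mulVec_transpose, transpose_transpose]
  simp only [star_trivial, sampleCov, sub_mulVec, smul_mulVec, one_mulVec, dotProduct_sub,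
    dotProduct_smul, smul_eq_mul] at h
  rw [← e] at h
  have ha0 : 0 ≤ a ⬝ᵥ a := by simpa using dotProduct_star_self_nonneg a
  have h1 : (X ℓ *ᵥ a) ⬝ᵥ (X ℓ *ᵥ a) ≤ c₀ * (a ⬝ᵥ a) * n ℓ := by
    rw [← div_le_iff₀ hn, div_eq_inv_mul, ← one_div]
    linarith
  refine h1.trans ?_
  calc c₀ * (a ⬝ᵥ a) * n ℓ ≤ c₀ * (a ⬝ᵥ a) * (p / γ₀) := by
        gcongr; exact hX.natCast_le hγ ℓ
    _ = _ := by ring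

end Design

/-! ### The score: centring and tails. -/

noncomputable section Score

/-- The `i`-th column of the design, normalized by `√p`. -/
def scaledCol {m p : ℕ} (X : Matrix (Fin m) (Fin p) ℝ) (i : Fin p) : Fin m → ℝ :=
  (√(p : ℝ))⁻¹ • X.col i

/-- The deviation of `y yᵀ` from its model mean `p⁻¹ X Ω Xᵀ + σ² I`. -/
def residual {m p : ℕ} (X : Matrix (Fin m) (Fin p) ℝ) (y : Fin m → ℝ)
    (Ω : Matrix (Fin p) (Fin p) ℝ) (σ : ℝ) : Matrix (Fin m) (Fin m) ℝ :=
  vecMulVec y y - (1 / (p : ℝ)) • (X * Ω * Xᵀ) - σ ^ 2 • (1 : Matrix (Fin m) (Fin m) ℝ)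

/-- The normalized residual `p⁻¹ Xᵀ R X` in the coefficient space. -/
def score {m p : ℕ} (X : Matrix (Fin m) (Fin p) ℝ) (y : Fin m → ℝ)
    (Ω : Matrix (Fin p) (Fin p) ℝ) (σ : ℝ) : Matrix (Fin p) (Fin p) ℝ :=
  (1 / (p : ℝ)) • (Xᵀ * residual X y Ω σ * X)

/-- Splitting 1/p as (1/√p)² between the two columns exhibits the random part as a product of two
linear forms in y. -/
lemma score_apply {m p : ℕ} (X : Matrix (Fin m) (Fin p) ℝ) (y : Fin m → ℝ)
    (Ω : Matrix (Fin p) (Fin p) ℝ) (σ : ℝ) (i j : Fin p) :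
    score X y Ω σ i j = (scaledCol X i ⬝ᵥ y) * (scaledCol X j ⬝ᵥ y)
      - scaledCol X i ⬝ᵥ (((1 / (p : ℝ)) • (X * Ω * Xᵀ)
        + σ ^ 2 • (1 : Matrix (Fin m) (Fin m) ℝ)) *ᵥ scaledCol X j) := by
  have hform : ∀ M : Matrix (Fin m) (Fin m) ℝ,
      (Xᵀ * M * X) i j = X.col i ⬝ᵥ (M *ᵥ X.col j) := by
    intro M
    rw [Matrix.mul_assoc]
    rfl
  have hp : (√(p : ℝ))⁻¹ * (√(p : ℝ))⁻¹ = 1 / (p : ℝ) := by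
    rw [← mul_inv, Real.mul_self_sqrt (Nat.cast_nonneg _), one_div]
  have hr : residual X y Ω σ = vecMulVec y y - ((1 / (p : ℝ)) • (X * Ω * Xᵀ)
        + σ ^ 2 • (1 : Matrix (Fin m) (Fin m) ℝ)) := by
    rw [residual, sub_sub]
  rw [score, Matrix.smul_apply, hform, hr, sub_mulVec, dotProduct_sub, vecMulVec_mulVec]
  simp only [scaledCol, smul_dotProduct, mulVec_smul, dotProduct_smul, smul_eq_mul,
    op_smul_eq_smul, ← hp]
  rw [dotProduct_comm y (X.col j)]
  ring

variable {p L : ℕ} {n : Fin L → ℕ} {X : ∀ ℓ, Matrix (Fin (n ℓ)) (Fin p) ℝ} {γ₀ c₀ κ : ℝ}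
  {S : Type*} [MeasurableSpace S] {μ : Measure S} {β : Fin L → S → Fin p → ℝ}
  {ε : ∀ ℓ, S → Fin (n ℓ) → ℝ} {Ω : Matrix (Fin p) (Fin p) ℝ} {σ : ℝ} {τβ τε : ℝ≥0}

lemma dotProduct_response {m : ℕ} (X : Matrix (Fin m) (Fin p) ℝ) (b : Fin p → ℝ) (e u : Fin m → ℝ) :
    u ⬝ᵥ response X b e = (Xᵀ *ᵥ u) ⬝ᵥ b + u ⬝ᵥ e := by
  rw [response, dotProduct_add, dotProduct_mulVec, ← mulVec_transpose]

lemma IsRandomEffects.mean_sqrt_smul_coef (h : IsRandomEffects μ β ε Ω σ τβ τε) (ℓ : Fin L)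
    (i : Fin p) : ∫ ω, (√(p : ℝ) • β ℓ ω) i ∂μ = 0 := by
  simp only [Pi.smul_apply, smul_eq_mul]
  rw [integral_const_mul, h.mean_coef, mul_zero]

lemma IsRandomEffects.memLp_coef [IsProbabilityMeasure μ]
    (h : IsRandomEffects μ β ε Ω σ τβ τε) (hp : 0 < p) (ℓ : Fin L) (i : Fin p) :
    MemLp (fun ω => β ℓ ω i) 2 μ := by
  have h1 := ((h.subGaussian_coef ℓ).memLp (h.mean_sqrt_smul_coef ℓ) i).const_mul (√(p : ℝ))⁻¹
  have hp' : √(p : ℝ) ≠ 0 := by positivity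
  simpa [← mul_assoc, inv_mul_cancel₀ hp'] using h1

lemma IsRandomEffects.memLp_noise [IsProbabilityMeasure μ]
    (h : IsRandomEffects μ β ε Ω σ τβ τε) (ℓ : Fin L) (i : Fin (n ℓ)) :
    MemLp (fun ω => ε ℓ ω i) 2 μ :=
  (h.subGaussian_noise ℓ).memLp (h.mean_noise ℓ) i

lemma IsRandomEffects.integral_coef_mul_noise [IsProbabilityMeasure μ]
    (h : IsRandomEffects μ β ε Ω σ τβ τε) (ℓ : Fin L) (i : Fin p) (j : Fin (n ℓ)) :
    ∫ ω, β ℓ ω i * ε ℓ ω j ∂μ = 0 := by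
  have hi : IndepFun (fun ω => β ℓ ω i) (fun ω => ε ℓ ω j) μ :=
    (h.indep_coef_noise ℓ).comp (measurable_pi_apply i) (measurable_pi_apply j)
  have := hi.integral_fun_mul_eq_mul_integral
    ((measurable_pi_apply i).comp (h.measurable_coef ℓ)).aestronglyMeasurable
    ((measurable_pi_apply j).comp (h.measurable_noise ℓ)).aestronglyMeasurable
  rw [this, h.mean_coef, zero_mul]

/-- Ω is p times the covariance of any one coefficient vector. This is what makes Ω an admissible
competitor; a task ℓ must exist. -/
lemma IsRandomEffects.posSemidef [IsProbabilityMeasure μ]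
    (h : IsRandomEffects μ β ε Ω σ τβ τε) (hp : 0 < p) (ℓ : Fin L) : Ω.PosSemidef := by
  have hp' : (0 : ℝ) < p := by exact_mod_cast hp
  refine PosSemidef.of_dotProduct_mulVec_nonneg ?_ fun a => ?_
  · ext i j
    have h1 := h.cov_coef ℓ i j
    have h2 := h.cov_coef ℓ j i
    simp only [mul_comm (β ℓ _ j)] at h2
    rw [h1, div_left_inj' hp'.ne'] at h2
    simpa using h2.symm
  · have h1 := integral_dotProduct_mul_dotProduct (h.memLp_coef hp ℓ) (h.memLp_coef hp ℓ)
      (M := (1 / (p : ℝ)) • Ω) (fun i j => by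
        rw [h.cov_coef, Matrix.smul_apply, smul_eq_mul]; ring) a a
    have h2 : 0 ≤ ∫ ω, (a ⬝ᵥ β ℓ ω) * (a ⬝ᵥ β ℓ ω) ∂μ :=
      integral_nonneg fun ω => mul_self_nonneg _
    rw [h1, smul_mulVec, dotProduct_smul, smul_eq_mul] at h2
    simpa using nonneg_of_mul_nonneg_right h2 (by positivity : (0 : ℝ) < 1 / p)

/-- Coefficient–noise cross terms vanish by independence and centring. The result is the term
subtracted in `score_apply`, so scores have mean zero. -/
lemma IsRandomEffects.integral_response_mul_response [IsProbabilityMeasure μ]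
    (h : IsRandomEffects μ β ε Ω σ τβ τε) (hp : 0 < p) (ℓ : Fin L) (u v : Fin (n ℓ) → ℝ) :
    ∫ ω, (u ⬝ᵥ response (X ℓ) (β ℓ ω) (ε ℓ ω)) * (v ⬝ᵥ response (X ℓ) (β ℓ ω) (ε ℓ ω)) ∂μ
      = u ⬝ᵥ (((1 / (p : ℝ)) • (X ℓ * Ω * (X ℓ)ᵀ)
        + σ ^ 2 • (1 : Matrix (Fin (n ℓ)) (Fin (n ℓ)) ℝ)) *ᵥ v) := by
  have hb := h.memLp_coef hp ℓ
  have he := h.memLp_noise ℓ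
  set a := (X ℓ)ᵀ *ᵥ u with ha
  set b := (X ℓ)ᵀ *ᵥ v with hbd
  have e1 := integral_dotProduct_mul_dotProduct hb hb (M := (1 / (p : ℝ)) • Ω) (fun i j => by
    rw [h.cov_coef, Matrix.smul_apply, smul_eq_mul]; ring) a b
  have e2 := integral_dotProduct_mul_dotProduct hb he (M := 0) (fun i j => by
    rw [h.integral_coef_mul_noise]; rfl) a v
  have e3 := integral_dotProduct_mul_dotProduct hb he (M := 0) (fun i j => by
    rw [h.integral_coef_mul_noise]; rfl) b u
  have e4 := integral_dotProduct_mul_dotProduct he he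
    (M := σ ^ 2 • (1 : Matrix (Fin (n ℓ)) (Fin (n ℓ)) ℝ)) (fun i j => by
      rw [h.cov_noise, Matrix.smul_apply, one_apply]; simp) u v
  have i1 : Integrable (fun ω => (a ⬝ᵥ β ℓ ω) * (b ⬝ᵥ β ℓ ω)) μ :=
    (memLp_dotProduct hb a).integrable_mul (memLp_dotProduct hb b)
  have i2 : Integrable (fun ω => (a ⬝ᵥ β ℓ ω) * (v ⬝ᵥ ε ℓ ω)) μ :=
    (memLp_dotProduct hb a).integrable_mul (memLp_dotProduct he v)
  have i3 : Integrable (fun ω => (b ⬝ᵥ β ℓ ω) * (u ⬝ᵥ ε ℓ ω)) μ :=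
    (memLp_dotProduct hb b).integrable_mul (memLp_dotProduct he u)
  have i4 : Integrable (fun ω => (u ⬝ᵥ ε ℓ ω) * (v ⬝ᵥ ε ℓ ω)) μ :=
    (memLp_dotProduct he u).integrable_mul (memLp_dotProduct he v)
  have hexp : ∀ ω, (u ⬝ᵥ response (X ℓ) (β ℓ ω) (ε ℓ ω)) * (v ⬝ᵥ response (X ℓ) (β ℓ ω) (ε ℓ ω))
      = ((a ⬝ᵥ β ℓ ω) * (b ⬝ᵥ β ℓ ω) + (a ⬝ᵥ β ℓ ω) * (v ⬝ᵥ ε ℓ ω))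
        + ((b ⬝ᵥ β ℓ ω) * (u ⬝ᵥ ε ℓ ω) + (u ⬝ᵥ ε ℓ ω) * (v ⬝ᵥ ε ℓ ω)) := fun ω => by
    rw [dotProduct_response, dotProduct_response]; ring
  have hquad : u ⬝ᵥ ((X ℓ * Ω * (X ℓ)ᵀ) *ᵥ v) = a ⬝ᵥ (Ω *ᵥ b) := by
    rw [← mulVec_mulVec, ← hbd, ← mulVec_mulVec, dotProduct_mulVec u (X ℓ), ← mulVec_transpose,
      ← ha]
  simp only [hexp]
  rw [integral_add (by exact i1.add i2) (by exact i3.add i4), integral_add i1 i2,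
    integral_add i3 i4, e1, e2, e3, e4, add_mulVec, dotProduct_add, smul_mulVec, smul_mulVec,
    smul_mulVec, dotProduct_smul, dotProduct_smul, dotProduct_smul, hquad]
  simp

/-- The variance proxy of the normalized responses. -/
def proxy (τβ τε : ℝ≥0) (γ₀ c₀ : ℝ) : ℝ≥0 :=
  (c₀ / γ₀).toNNReal ^ 2 * τβ ^ 2 + (c₀ / γ₀).toNNReal * τε ^ 2 + 1

/-- The summand 1 covers τβ = τε = 0, so that one may divide by the proxy. -/
lemma proxy_pos (τβ τε : ℝ≥0) (γ₀ c₀ : ℝ) : 0 < proxy τβ τε γ₀ c₀ := by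
  unfold proxy; positivity

/-- With r = c₀/γ₀, the scaled column u has ‖u‖² ≤ r and ‖Xᵀu/√p‖² ≤ r². Proxies of the independent
coefficient and noise parts add, free of the dimensions. -/
lemma IsRandomEffects.hasSubgaussianMGF_scaledCol_response [IsProbabilityMeasure μ]
    (h : IsRandomEffects μ β ε Ω σ τβ τε) (hX : IsFixedDesign X γ₀ c₀ κ) (hγ : 0 < γ₀)
    (hc : 0 < c₀) (hp : 0 < p) (ℓ : Fin L) (i : Fin p) :
    HasSubgaussianMGF (fun ω => scaledCol (X ℓ) i ⬝ᵥ response (X ℓ) (β ℓ ω) (ε ℓ ω))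
      (proxy τβ τε γ₀ c₀) μ := by
  have hp' : (0 : ℝ) < p := by exact_mod_cast hp
  set r : ℝ := c₀ / γ₀ with hr
  have hr0 : 0 < r := by positivity
  set u := scaledCol (X ℓ) i with hu
  have hu1 : u ⬝ᵥ u ≤ r := by
    have h1 := hX.mulVec_dotProduct_self_le hγ hc ℓ (Pi.single i 1)
    rw [mulVec_single_one] at h1
    simp only [single_one_dotProduct, Pi.single_eq_same, mul_one] at h1
    rw [hu, scaledCol, smul_dotProduct, dotProduct_smul, smul_eq_mul, smul_eq_mul, ← mul_assoc,
      ← mul_inv, Real.mul_self_sqrt hp'.le, inv_mul_le_iff₀ hp']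
    linarith
  have ha := transpose_mulVec_dotProduct_self_le (by positivity)
    (hX.mulVec_dotProduct_self_le hγ hc ℓ) u
  set a := (X ℓ)ᵀ *ᵥ u with had
  have ha' : ((√(p : ℝ))⁻¹ • a) ⬝ᵥ ((√(p : ℝ))⁻¹ • a) ≤ r ^ 2 := by
    rw [smul_dotProduct, dotProduct_smul, smul_eq_mul, smul_eq_mul, ← mul_assoc,
      ← mul_inv, Real.mul_self_sqrt hp'.le, inv_mul_le_iff₀ hp']
    calc a ⬝ᵥ a ≤ r * p * (u ⬝ᵥ u) := ha
      _ ≤ r * p * r := by gcongr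
      _ = _ := by ring
  have s1 : HasSubgaussianMGF (fun ω => a ⬝ᵥ β ℓ ω) (r.toNNReal ^ 2 * τβ ^ 2) μ := by
    have := (h.subGaussian_coef ℓ).hasSubgaussianMGF_dotProduct (h.mean_sqrt_smul_coef ℓ)
      ((√(p : ℝ))⁻¹ • a) (V := r.toNNReal ^ 2 * τβ ^ 2) (by
        push_cast
        rw [Real.coe_toNNReal _ hr0.le]
        gcongr)
    have hs : √(p : ℝ) ≠ 0 := by positivity
    simpa [smul_dotProduct, dotProduct_smul, ← mul_assoc, mul_inv_cancel₀ hs] using this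
  have s2 : HasSubgaussianMGF (fun ω => u ⬝ᵥ ε ℓ ω) (r.toNNReal * τε ^ 2) μ :=
    (h.subGaussian_noise ℓ).hasSubgaussianMGF_dotProduct (h.mean_noise ℓ) u (by
        push_cast
        rw [Real.coe_toNNReal _ hr0.le]
        gcongr)
  have hind : IndepFun (fun ω => a ⬝ᵥ β ℓ ω) (fun ω => u ⬝ᵥ ε ℓ ω) μ :=
    (h.indep_coef_noise ℓ).comp (φ := fun b => a ⬝ᵥ b) (ψ := fun e => u ⬝ᵥ e)
      (by unfold dotProduct; fun_prop) (by unfold dotProduct; fun_prop)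
  have s3 := (s1.add_of_indepFun s2 hind).mono (d := proxy τβ τε γ₀ c₀) (by
    unfold proxy; exact le_self_add)
  simpa only [dotProduct_response] using s3

lemma measurable_score_apply {m : ℕ} (X : Matrix (Fin m) (Fin p) ℝ)
    (Ω : Matrix (Fin p) (Fin p) ℝ) (σ : ℝ) (i j : Fin p) {y : S → Fin m → ℝ} (hy : Measurable y) :
    Measurable fun ω => score X (y ω) Ω σ i j := by
  simp only [score_apply]
  unfold dotProduct
  fun_prop

lemma IsRandomEffects.measurable_response (h : IsRandomEffects μ β ε Ω σ τβ τε) (ℓ : Fin L) :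
    Measurable fun ω => response (X ℓ) (β ℓ ω) (ε ℓ ω) := by
  have h1 := h.measurable_coef ℓ
  have h2 := h.measurable_noise ℓ
  unfold response
  simp only [mulVec, dotProduct, measurable_pi_iff, Pi.add_apply]
  intro i
  fun_prop

/-- Tail bound for one entry of the sum of the scores. -/
lemma IsRandomEffects.measureReal_abs_sum_score_ge_le [IsProbabilityMeasure μ]
    (h : IsRandomEffects μ β ε Ω σ τβ τε) (hX : IsFixedDesign X γ₀ c₀ κ) (hγ : 0 < γ₀)
    (hc : 0 < c₀) (hp : 0 < p) (i j : Fin p) {θ t : ℝ} (hθ : θ = 3 / (8 * proxy τβ τε γ₀ c₀))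
    (ht : 0 ≤ t) (htθ : t ≤ 16 / θ) :
    μ.real {ω | L * t ≤ |∑ ℓ, score (X ℓ) (response (X ℓ) (β ℓ ω) (ε ℓ ω)) Ω σ i j|}
      ≤ 2 * Real.exp (-(L * t ^ 2 * θ ^ 2 / 64)) := by
  have hV : (0 : ℝ) < proxy τβ τε γ₀ c₀ := proxy_pos τβ τε γ₀ c₀
  have hθ0 : 0 < θ := by rw [hθ]; positivity
  let g : ∀ ℓ, (Fin p → ℝ) × (Fin (n ℓ) → ℝ) → ℝ := fun ℓ q =>
    (scaledCol (X ℓ) i ⬝ᵥ response (X ℓ) q.1 q.2) * (scaledCol (X ℓ) j ⬝ᵥ response (X ℓ) q.1 q.2)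
  have hg : ∀ ℓ, Measurable (g ℓ) := fun ℓ => by
    simp only [g, dotProduct_response]
    unfold dotProduct
    fun_prop
  have hind : iIndepFun (fun ℓ ω => g ℓ (β ℓ ω, ε ℓ ω)) μ := h.indep_tasks.comp g hg
  have hmom := fun ℓ => integral_exp_abs_mul_le (proxy_pos τβ τε γ₀ c₀)
    (h.hasSubgaussianMGF_scaledCol_response hX hγ hc hp ℓ i)
    (h.hasSubgaussianMGF_scaledCol_response hX hγ hc hp ℓ j)
  rw [← hθ] at hmom
  have key := measureReal_abs_sum_sub_integral_ge_le (w := fun ℓ ω => g ℓ (β ℓ ω, ε ℓ ω))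
    (fun ℓ => (hg ℓ).comp ((h.measurable_coef ℓ).prodMk (h.measurable_noise ℓ))) hind hθ0 ht htθ
    (fun ℓ => (hmom ℓ).1) (fun ℓ => (hmom ℓ).2)
  have hs : ∀ ω ℓ, score (X ℓ) (response (X ℓ) (β ℓ ω) (ε ℓ ω)) Ω σ i j
      = g ℓ (β ℓ ω, ε ℓ ω) - ∫ ω', g ℓ (β ℓ ω', ε ℓ ω') ∂μ := fun ω ℓ => by
    rw [score_apply, ← h.integral_response_mul_response hp ℓ]
  simpa only [hs, Fintype.card_fin] using key

end Score

end HyperCov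

namespace HyperCov

/-! ### Deterministic error bounds for the minimizer. -/

section BasicInequality

lemma frobenius_norm_sq {a b : Type*} [Fintype a] [Fintype b] (A : Matrix a b ℝ) :
    ‖A‖ ^ 2 = ∑ i, ∑ j, A i j ^ 2 := by
  rw [frobenius_norm_def, ← Real.sqrt_eq_rpow, Real.sq_sqrt (by positivity)]
  simp

lemma abs_apply_le_frobenius_norm {a b : Type*} [Fintype a] [Fintype b] (A : Matrix a b ℝ)
    (i : a) (j : b) : |A i j| ≤ ‖A‖ := by
  refine abs_le_of_sq_le_sq ?_ (norm_nonneg A)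
  rw [frobenius_norm_sq]
  calc A i j ^ 2 ≤ ∑ j, A i j ^ 2 :=
        Finset.single_le_sum (f := fun j => A i j ^ 2) (fun _ _ => sq_nonneg _) (Finset.mem_univ j)
    _ ≤ _ := Finset.single_le_sum (f := fun i => ∑ j, A i j ^ 2)
        (fun _ _ => Finset.sum_nonneg fun _ _ => sq_nonneg _) (Finset.mem_univ i)

lemma frobenius_norm_sub_sq {a b : Type*} [Fintype a] [Fintype b] (A B : Matrix a b ℝ) :
    ‖A - B‖ ^ 2 = ‖A‖ ^ 2 - 2 * (∑ i, ∑ j, A i j * B i j) + ‖B‖ ^ 2 := by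
  simp only [frobenius_norm_sq, Finset.mul_sum, ← Finset.sum_sub_distrib, ← Finset.sum_add_distrib]
  refine Finset.sum_congr rfl fun i _ => Finset.sum_congr rfl fun j _ => ?_
  rw [Matrix.sub_apply]
  ring

/-- For the trace inner product, Δ ↦ XΔXᵀ has adjoint N ↦ XᵀNX; this moves the residual into
coefficient space. -/
lemma sum_mul_conj_eq {a b : Type*} [Fintype a] [Fintype b] (N : Matrix a a ℝ) (X : Matrix a b ℝ)
    (Δ : Matrix b b ℝ) :
    ∑ i, ∑ j, N i j * (X * Δ * Xᵀ) i j = ∑ i, ∑ j, (Xᵀ * N * X) i j * Δ i j := by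
  have h1 := sum_hadamard_eq N (X * Δ * Xᵀ)
  have h2 := sum_hadamard_eq (Xᵀ * N * X) Δ
  simp only [hadamard_apply] at h1 h2
  rw [h1, h2, transpose_mul, transpose_mul, transpose_transpose, Matrix.mul_assoc (Xᵀ * N) X,
    Matrix.mul_assoc Xᵀ N, trace_mul_comm Xᵀ]
  simp only [Matrix.mul_assoc]

lemma norm_kronecker_mulVec_vec_sq {m d : ℕ} (X : Matrix (Fin m) (Fin d) ℝ)
    (Δ : Matrix (Fin d) (Fin d) ℝ) :
    ‖WithLp.toLp 2 ((X ⊗ₖ X) *ᵥ vec Δ)‖ ^ 2 = ‖X * Δ * Xᵀ‖ ^ 2 := by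
  rw [kronecker_mulVec_vec, EuclideanSpace.norm_sq_eq, frobenius_norm_sq, Fintype.sum_prod_type,
    Finset.sum_comm]
  simp [vec]

variable {p L : ℕ} {n : Fin L → ℕ} {X : ∀ ℓ, Matrix (Fin (n ℓ)) (Fin p) ℝ} {γ₀ c₀ κ : ℝ}
  {y : ∀ ℓ, Fin (n ℓ) → ℝ} {σ lam : ℝ} {Ω W : Matrix (Fin p) (Fin p) ℝ}

lemma objective_eq_add (X : ∀ ℓ, Matrix (Fin (n ℓ)) (Fin p) ℝ) (y : ∀ ℓ, Fin (n ℓ) → ℝ)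
    (σ lam : ℝ) (Ω W : Matrix (Fin p) (Fin p) ℝ) :
    objective X y σ lam W = objective X y σ lam Ω
      + (1 / (L : ℝ)) * ∑ ℓ, (1 / (p : ℝ) ^ 2) * ‖X ℓ * (W - Ω) * (X ℓ)ᵀ‖ ^ 2
      - ∑ i, ∑ j, (2 / (L : ℝ) * ∑ ℓ, score (X ℓ) (y ℓ) Ω σ i j) * (W - Ω) i j
      + lam * (∑ i, ∑ j ∈ Finset.univ.erase i, |W i j|
        - ∑ i, ∑ j ∈ Finset.univ.erase i, |Ω i j|) := by
  have h1 : ∀ ℓ, ‖vecMulVec (y ℓ) (y ℓ) - (1 / (p : ℝ)) • (X ℓ * W * (X ℓ)ᵀ)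
      - σ ^ 2 • (1 : Matrix (Fin (n ℓ)) (Fin (n ℓ)) ℝ)‖ ^ 2
      = ‖residual (X ℓ) (y ℓ) Ω σ‖ ^ 2
        - 2 * (∑ i, ∑ j, score (X ℓ) (y ℓ) Ω σ i j * (W - Ω) i j)
        + (1 / (p : ℝ) ^ 2) * ‖X ℓ * (W - Ω) * (X ℓ)ᵀ‖ ^ 2 := by
    intro ℓ
    have e1 : vecMulVec (y ℓ) (y ℓ) - (1 / (p : ℝ)) • (X ℓ * W * (X ℓ)ᵀ)
        - σ ^ 2 • (1 : Matrix (Fin (n ℓ)) (Fin (n ℓ)) ℝ)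
        = residual (X ℓ) (y ℓ) Ω σ - (1 / (p : ℝ)) • (X ℓ * (W - Ω) * (X ℓ)ᵀ) := by
      rw [residual, Matrix.mul_sub, Matrix.sub_mul, smul_sub]
      abel
    have e2 : ‖(1 / (p : ℝ)) • (X ℓ * (W - Ω) * (X ℓ)ᵀ)‖ ^ 2
        = (1 / (p : ℝ) ^ 2) * ‖X ℓ * (W - Ω) * (X ℓ)ᵀ‖ ^ 2 := by
      simp only [frobenius_norm_sq, Finset.mul_sum, Matrix.smul_apply, smul_eq_mul]
      refine Finset.sum_congr rfl fun i _ => Finset.sum_congr rfl fun j _ => by ring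
    have e3 : ∑ i, ∑ j, residual (X ℓ) (y ℓ) Ω σ i j
          * ((1 / (p : ℝ)) • (X ℓ * (W - Ω) * (X ℓ)ᵀ)) i j
        = ∑ i, ∑ j, score (X ℓ) (y ℓ) Ω σ i j * (W - Ω) i j := by
      rw [← Matrix.smul_mul, ← Matrix.mul_smul, sum_mul_conj_eq]
      refine Finset.sum_congr rfl fun i _ => Finset.sum_congr rfl fun j _ => ?_
      rw [score, Matrix.smul_apply, Matrix.smul_apply, smul_eq_mul, smul_eq_mul]
      ring
    rw [e1, frobenius_norm_sub_sq, e2, e3]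
  have h2 : ∑ i, ∑ j, (2 / (L : ℝ) * ∑ ℓ, score (X ℓ) (y ℓ) Ω σ i j) * (W - Ω) i j
      = (1 / (L : ℝ)) * ∑ ℓ, 2 * (∑ i, ∑ j, score (X ℓ) (y ℓ) Ω σ i j * (W - Ω) i j) := by
    simp only [Finset.mul_sum, Finset.sum_mul]
    rw [Finset.sum_comm]
    conv_rhs => rw [Finset.sum_comm]
    rw [Finset.sum_comm]
    refine Finset.sum_congr rfl fun i _ => ?_
    rw [Finset.sum_comm]
    refine Finset.sum_congr rfl fun ℓ _ => Finset.sum_congr rfl fun j _ => by ring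
  rw [h2]
  unfold objective
  simp only [h1]
  rw [Finset.sum_add_distrib, Finset.sum_sub_distrib]
  unfold residual
  ring

/-- Although the minimizer is only compared with positive definite matrices, it also beats
positive semidefinite ones. -/
lemma IsPenalizedMinimizer.objective_le (hW : IsPenalizedMinimizer X y σ lam W)
    (hΩ : Ω.PosSemidef) : objective X y σ lam W ≤ objective X y σ lam Ω := by
  -- Ω + t·1 is positive definite for t > 0, and the penalty ignores the diagonal. The objective
  -- along this ray is thus a polynomial in t, and t → 0⁺ suffices.
  obtain ⟨a, b, hab⟩ : ∃ a b : ℝ, ∀ t : ℝ,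
      objective X y σ lam (Ω + t • 1) = objective X y σ lam Ω + (t ^ 2 * a - t * b) := by
    refine ⟨(1 / (L : ℝ)) * ∑ ℓ, (1 / (p : ℝ) ^ 2)
        * ‖X ℓ * (1 : Matrix (Fin p) (Fin p) ℝ) * (X ℓ)ᵀ‖ ^ 2,
      ∑ i, ∑ j, (2 / (L : ℝ) * ∑ ℓ, score (X ℓ) (y ℓ) Ω σ i j)
        * (1 : Matrix (Fin p) (Fin p) ℝ) i j, fun t => ?_⟩
    rw [objective_eq_add X y σ lam Ω (Ω + t • 1)]
    have hpen : ∑ i, ∑ j ∈ Finset.univ.erase i, |(Ω + t • (1 : Matrix (Fin p) (Fin p) ℝ)) i j|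
        = ∑ i, ∑ j ∈ Finset.univ.erase i, |Ω i j| := by
      refine Finset.sum_congr rfl fun i _ => Finset.sum_congr rfl fun j hj => ?_
      have : i ≠ j := (Finset.ne_of_mem_erase hj).symm
      simp [one_apply_ne this]
    have hsq : ∀ ℓ, ‖X ℓ * (t • (1 : Matrix (Fin p) (Fin p) ℝ)) * (X ℓ)ᵀ‖ ^ 2
        = t ^ 2 * ‖X ℓ * (1 : Matrix (Fin p) (Fin p) ℝ) * (X ℓ)ᵀ‖ ^ 2 := fun ℓ => by
      rw [Matrix.mul_smul, Matrix.smul_mul]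
      simp only [frobenius_norm_sq, Finset.mul_sum, Matrix.smul_apply, smul_eq_mul, mul_pow]
    rw [hpen, add_sub_cancel_left]
    simp only [hsq, Matrix.smul_apply, smul_eq_mul]
    have e1 : ∀ ℓ, (1 / (p : ℝ) ^ 2)
          * (t ^ 2 * ‖X ℓ * (1 : Matrix (Fin p) (Fin p) ℝ) * (X ℓ)ᵀ‖ ^ 2)
        = t ^ 2 * ((1 / (p : ℝ) ^ 2) * ‖X ℓ * (1 : Matrix (Fin p) (Fin p) ℝ) * (X ℓ)ᵀ‖ ^ 2) :=
      fun ℓ => by ring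
    have e2 : ∀ i j, (2 / (L : ℝ) * ∑ ℓ, score (X ℓ) (y ℓ) Ω σ i j)
          * (t * (1 : Matrix (Fin p) (Fin p) ℝ) i j)
        = t * ((2 / (L : ℝ) * ∑ ℓ, score (X ℓ) (y ℓ) Ω σ i j)
          * (1 : Matrix (Fin p) (Fin p) ℝ) i j) := fun i j => by ring
    simp only [e1, e2, ← Finset.mul_sum]
    ring
  have hlim : Tendsto (fun t : ℝ => objective X y σ lam Ω + (t ^ 2 * a - t * b)) (𝓝[>] 0)
      (𝓝 (objective X y σ lam Ω)) := by
    have : Continuous fun t : ℝ => objective X y σ lam Ω + (t ^ 2 * a - t * b) := by fun_prop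
    simpa using (this.tendsto 0).mono_left nhdsWithin_le_nhds
  refine ge_of_tendsto hlim (eventually_mem_nhdsWithin.mono fun t ht => ?_)
  rw [← hab]
  exact hW.2 _ (PosDef.posSemidef_add hΩ (PosDef.one.smul ht))

lemma IsPenalizedMinimizer.basic_inequality (hW : IsPenalizedMinimizer X y σ lam W)
    (hΩ : Ω.PosSemidef) (hX : IsFixedDesign X γ₀ c₀ κ) (hL : 0 < L) :
    κ * ‖W - Ω‖ ^ 2 ≤ (∑ i, ∑ j, |2 / (L : ℝ) * ∑ ℓ, score (X ℓ) (y ℓ) Ω σ i j| * |(W - Ω) i j|)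
      + lam * (∑ i, ∑ j ∈ Finset.univ.erase i, |Ω i j|
        - ∑ i, ∑ j ∈ Finset.univ.erase i, |W i j|) := by
  have hL' : (0 : ℝ) < L := by exact_mod_cast hL
  have h := hW.objective_le hΩ
  rw [objective_eq_add X y σ lam Ω W] at h
  have hsymm : (W - Ω).IsSymm := by
    have h1 := hW.1.1
    have h2 := hΩ.1
    rw [IsHermitian, conjTranspose_eq_transpose_of_trivial] at h1 h2
    rw [Matrix.IsSymm, transpose_sub, h1, h2]
  have hre : κ * ‖W - Ω‖ ^ 2
      ≤ (1 / (L : ℝ)) * ∑ ℓ, (1 / (p : ℝ) ^ 2) * ‖X ℓ * (W - Ω) * (X ℓ)ᵀ‖ ^ 2 := by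
    have h1 : ∑ _ℓ : Fin L, κ * ‖W - Ω‖ ^ 2
        ≤ ∑ ℓ, (1 / (p : ℝ) ^ 2) * ‖X ℓ * (W - Ω) * (X ℓ)ᵀ‖ ^ 2 :=
      Finset.sum_le_sum fun ℓ _ => by
        rw [← norm_kronecker_mulVec_vec_sq]
        exact hX.restricted_eigenvalue ℓ _ hsymm
    rw [Finset.sum_const, Finset.card_univ, Fintype.card_fin, nsmul_eq_mul] at h1
    rw [one_div, ← div_eq_inv_mul, le_div_iff₀ hL']
    linarith
  have hle : ∑ i, ∑ j, (2 / (L : ℝ) * ∑ ℓ, score (X ℓ) (y ℓ) Ω σ i j) * (W - Ω) i j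
      ≤ ∑ i, ∑ j, |2 / (L : ℝ) * ∑ ℓ, score (X ℓ) (y ℓ) Ω σ i j| * |(W - Ω) i j| :=
    Finset.sum_le_sum fun i _ => Finset.sum_le_sum fun j _ =>
      (le_abs_self _).trans (abs_mul _ _).le
  linarith

lemma sum_offDiag_sub_eq (Ω W : Matrix (Fin p) (Fin p) ℝ) :
    ∑ i, ∑ j ∈ Finset.univ.erase i, |Ω i j| - ∑ i, ∑ j ∈ Finset.univ.erase i, |W i j|
      = ∑ i, ∑ j, if i = j then 0 else |Ω i j| - |W i j| := by
  rw [← Finset.sum_sub_distrib]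
  refine Finset.sum_congr rfl fun i _ => ?_
  rw [← Finset.sum_sub_distrib, ← Finset.sum_erase_add _ _ (Finset.mem_univ i)]
  simp only [if_true, add_zero]
  exact Finset.sum_congr rfl fun j hj => by
    rw [if_neg (Finset.ne_of_mem_erase hj).symm]

lemma cancel_norm_of_mul_sq_le {x a b : ℝ} (hx : 0 ≤ x) (hb : 0 ≤ b) (h : a * x ^ 2 ≤ b * x) :
    a * x ≤ b := by
  rcases hx.eq_or_lt with rfl | hx
  · simpa using hb
  · nlinarith

/-- Error bound when the penalty dominates the score. -/
lemma IsPenalizedMinimizer.norm_sub_le_of_score_le (hW : IsPenalizedMinimizer X y σ lam W)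
    (hΩ : Ω.PosSemidef) (hX : IsFixedDesign X γ₀ c₀ κ) (hL : 0 < L) {s : ℕ} (hlam : 0 ≤ lam)
    (hs : (offDiagSupport Ω).ncard ≤ s)
    (hscore : ∀ i j, |2 / (L : ℝ) * ∑ ℓ, score (X ℓ) (y ℓ) Ω σ i j| ≤ lam) :
    κ * ‖W - Ω‖ ≤ 2 * lam * √((p : ℝ) + s) := by
  classical
  refine cancel_norm_of_mul_sq_le (norm_nonneg _) (by positivity) ?_
  refine (hW.basic_inequality hΩ hX hL).trans ?_
  rw [sum_offDiag_sub_eq]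
  simp only [Finset.mul_sum _ _ lam, ← Finset.sum_add_distrib]
  -- T is the diagonal together with the support of Ω. Off T the penalty gain -λ|W_ij| cancels the
  -- score term; on T each of the two terms costs at most λ|Δ_ij|.
  set T : Finset (Fin p × Fin p) :=
    Finset.univ.filter fun ij => ij.1 = ij.2 ∨ Ω ij.1 ij.2 ≠ 0 with hT
  have hcard : (T.card : ℝ) ≤ (p : ℝ) + s := by
    have hsub : T ⊆ Finset.univ.image (fun i : Fin p => (i, i)) ∪ (offDiagSupport Ω).toFinset := by
      intro ij hij
      simp only [hT, Finset.mem_filter, Finset.mem_univ, true_and] at hij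
      by_cases h : ij.1 = ij.2
      · exact Finset.mem_union_left _ (Finset.mem_image.2 ⟨ij.1, Finset.mem_univ _, Prod.ext rfl h⟩)
      · refine Finset.mem_union_right _ (Set.mem_toFinset.2 ⟨hij.resolve_left h, h⟩)
    have h1 := (Finset.card_le_card hsub).trans (Finset.card_union_le _ _)
    have h2 : (Finset.univ.image (fun i : Fin p => (i, i))).card ≤ p :=
      Finset.card_image_le.trans (by simp)
    rw [Set.ncard_eq_toFinset_card'] at hs
    exact_mod_cast h1.trans (Nat.add_le_add h2 hs)
  have hpt : ∀ i j, |2 / (L : ℝ) * ∑ ℓ, score (X ℓ) (y ℓ) Ω σ i j| * |(W - Ω) i j|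
      + lam * (if i = j then 0 else |Ω i j| - |W i j|)
      ≤ if (i, j) ∈ T then 2 * lam * |(W - Ω) i j| else 0 := by
    intro i j
    have h1 := mul_le_mul_of_nonneg_right (hscore i j) (abs_nonneg ((W - Ω) i j))
    have h2 : 0 ≤ lam * |(W - Ω) i j| := by positivity
    simp only [hT, Finset.mem_filter, Finset.mem_univ, true_and]
    by_cases hij : i = j
    · rw [if_pos hij, if_pos (Or.inl hij)]
      linarith
    · rw [if_neg hij]
      by_cases h0 : Ω i j = 0
      · rw [if_neg (by simp [hij, h0]), h0]
        rw [Matrix.sub_apply, h0, sub_zero] at h1 ⊢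
        simp only [abs_zero]
        linarith
      · rw [if_pos (Or.inr h0)]
        have h3 : |Ω i j| - |W i j| ≤ |(W - Ω) i j| := by
          rw [Matrix.sub_apply, abs_sub_comm]; exact abs_sub_abs_le_abs_sub _ _
        have h4 := mul_le_mul_of_nonneg_left h3 hlam
        linarith
  refine (Finset.sum_le_sum fun i _ => Finset.sum_le_sum fun j _ => hpt i j).trans ?_
  rw [← Fintype.sum_prod_type'
    (f := fun i j => if (i, j) ∈ T then 2 * lam * |(W - Ω) i j| else 0)]
  simp only [Prod.mk.eta]
  rw [Finset.sum_ite_mem, Finset.univ_inter, ← Finset.mul_sum, mul_assoc (2 * lam) (√_)]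
  refine mul_le_mul_of_nonneg_left ?_ (by positivity)
  have hcs := sq_sum_le_card_mul_sum_sq (s := T) (f := fun ij => |(W - Ω) ij.1 ij.2|)
  have hfro : ∑ ij ∈ T, |(W - Ω) ij.1 ij.2| ^ 2 ≤ ‖W - Ω‖ ^ 2 := by
    rw [frobenius_norm_sq, ← Fintype.sum_prod_type' (f := fun i j => (W - Ω) i j ^ 2)]
    simp only [sq_abs]
    exact Finset.sum_le_sum_of_subset_of_nonneg (Finset.subset_univ _) fun _ _ _ => sq_nonneg _
  refine abs_le_of_sq_le_sq' ?_ (by positivity) |>.2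
  rw [mul_pow, Real.sq_sqrt (by positivity)]
  refine hcs.trans ?_
  gcongr

/-- Crude error bound, valid without any condition on the score. -/
lemma IsPenalizedMinimizer.norm_sub_le (hW : IsPenalizedMinimizer X y σ lam W)
    (hΩ : Ω.PosSemidef) (hX : IsFixedDesign X γ₀ c₀ κ) (hL : 0 < L) (hlam : 0 ≤ lam) :
    κ * ‖W - Ω‖ ≤ ∑ i, ∑ j, (|2 / (L : ℝ) * ∑ ℓ, score (X ℓ) (y ℓ) Ω σ i j| + lam) := by
  refine cancel_norm_of_mul_sq_le (norm_nonneg _)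
    (Finset.sum_nonneg fun i _ => Finset.sum_nonneg fun j _ => by positivity) ?_
  refine (hW.basic_inequality hΩ hX hL).trans ?_
  rw [sum_offDiag_sub_eq]
  simp only [Finset.mul_sum _ _ lam, Finset.sum_mul, ← Finset.sum_add_distrib]
  refine Finset.sum_le_sum fun i _ => Finset.sum_le_sum fun j _ => ?_
  rw [add_mul]
  have h1 := abs_apply_le_frobenius_norm (W - Ω) i j
  have h3 : |Ω i j| - |W i j| ≤ |(W - Ω) i j| := by
    rw [Matrix.sub_apply, abs_sub_comm]; exact abs_sub_abs_le_abs_sub _ _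
  refine add_le_add (mul_le_mul_of_nonneg_left h1 (abs_nonneg _))
    (mul_le_mul_of_nonneg_left ?_ hlam)
  split_ifs
  · positivity
  · exact h3.trans h1

end BasicInequality

end HyperCov

namespace HyperCov

/-! ### Uniform control of the score. -/

section Rate

lemma tendsto_measure_lt_atTop {S : Type*} [MeasurableSpace S] (μ : Measure S) [IsFiniteMeasure μ]
    {f : S → ℝ} (hf : Measurable f) : Tendsto (fun K : ℝ => μ {ω | K < f ω}) atTop (𝓝 0) := by
  have h := tendsto_measure_iInter_atTop (μ := μ) (s := fun K : ℝ => {ω | K < f ω})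
    (fun K => (measurableSet_lt measurable_const hf).nullMeasurableSet)
    (fun K K' hK ω hω => lt_of_le_of_lt hK hω) ⟨0, measure_ne_top _ _⟩
  have he : ⋂ K : ℝ, {ω | K < f ω} = ∅ := by
    ext ω
    simp only [Set.mem_iInter, Set.mem_ofPred_eq, Set.mem_empty_iff_false, iff_false, not_forall]
    exact ⟨f ω, lt_irrefl _⟩
  rwa [he, measure_empty] at h

variable {p L : ℕ} {n : Fin L → ℕ} {X : ∀ ℓ, Matrix (Fin (n ℓ)) (Fin p) ℝ} {γ₀ c₀ κ : ℝ}
  {S : Type*} [MeasurableSpace S] {μ : Measure S} {β : Fin L → S → Fin p → ℝ}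
  {ε : ∀ ℓ, S → Fin (n ℓ) → ℝ} {Ω : Matrix (Fin p) (Fin p) ℝ} {σ : ℝ} {τβ τε : ℝ≥0}

/-- With high probability, a penalty of order `√(log p / L)` dominates the score. -/
lemma IsRandomEffects.measure_score_gt_le [IsProbabilityMeasure μ]
    (h : IsRandomEffects μ β ε Ω σ τβ τε) (hX : IsFixedDesign X γ₀ c₀ κ) (hγ : 0 < γ₀)
    (hc : 0 < c₀) (hp : 2 ≤ p) (hL : 1 ≤ L) {θ lam : ℝ} (hθ : θ = 3 / (8 * proxy τβ τε γ₀ c₀))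
    (hlog : Real.log p / L ≤ 1) (hlam : 32 / θ * √(Real.log p / L) ≤ lam) :
    μ {ω | ∃ i j, lam < |2 / (L : ℝ)
        * ∑ ℓ, score (X ℓ) (response (X ℓ) (β ℓ ω) (ε ℓ ω)) Ω σ i j|}
      ≤ ENNReal.ofReal (2 / (p : ℝ) ^ 2) := by
  have hV : (0 : ℝ) < proxy τβ τε γ₀ c₀ := proxy_pos τβ τε γ₀ c₀
  have hθ0 : 0 < θ := by rw [hθ]; positivity
  have hp0 : 0 < p := by omega
  have hp' : (0 : ℝ) < p := by exact_mod_cast hp0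
  have hL' : (0 : ℝ) < L := by exact_mod_cast hL
  have hlog0 : 0 ≤ Real.log p / L := div_nonneg (Real.log_natCast_nonneg p) hL'.le
  -- The Bernstein exponent becomes 4 log p, so p² entries with tail 2p⁻⁴ sum to 2/p². The factor 2
  -- in 2/L turns 16/θ into 32/θ.
  set t : ℝ := 16 / θ * √(Real.log p / L) with ht
  have ht0 : 0 ≤ t := by positivity
  have htθ : t ≤ 16 / θ := by
    have : √(Real.log p / L) ≤ 1 := Real.sqrt_le_one.2 hlog
    calc t ≤ 16 / θ * 1 := by rw [ht]; gcongr
      _ = _ := mul_one _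
  have hexp : Real.exp (-(L * t ^ 2 * θ ^ 2 / 64)) = 1 / (p : ℝ) ^ 4 := by
    have : L * t ^ 2 * θ ^ 2 / 64 = 4 * Real.log p := by
      rw [ht, mul_pow, Real.sq_sqrt hlog0]
      field_simp
      ring
    rw [this, Real.exp_neg, one_div]
    congr 1
    rw [mul_comm, Real.exp_mul, Real.exp_log hp']
    norm_cast
  have hsub : {ω | ∃ i j, lam < |2 / (L : ℝ)
        * ∑ ℓ, score (X ℓ) (response (X ℓ) (β ℓ ω) (ε ℓ ω)) Ω σ i j|}
      ⊆ ⋃ ij : Fin p × Fin p, {ω | L * t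
        ≤ |∑ ℓ, score (X ℓ) (response (X ℓ) (β ℓ ω) (ε ℓ ω)) Ω σ ij.1 ij.2|} := by
    rintro ω ⟨i, j, hij⟩
    refine Set.mem_iUnion.2 ⟨(i, j), ?_⟩
    rw [abs_mul, abs_of_pos (by positivity : (0 : ℝ) < 2 / L), div_mul_eq_mul_div,
      lt_div_iff₀ hL'] at hij
    have h2 : 2 * t ≤ lam := by rw [ht]; linarith [hlam, show 2 * (16 / θ * √(Real.log p / L)) =
      32 / θ * √(Real.log p / L) by ring]
    have h3 := mul_le_mul_of_nonneg_right h2 hL'.le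
    simp only [Set.mem_ofPred_eq]
    linarith
  rw [← ofReal_measureReal]
  refine ENNReal.ofReal_le_ofReal ((measureReal_mono hsub).trans
    ((measureReal_iUnion_fintype_le _).trans ?_))
  refine (Finset.sum_le_sum fun ij _ =>
    h.measureReal_abs_sum_score_ge_le hX hγ hc hp0 ij.1 ij.2 hθ ht0 htθ).trans ?_
  rw [Finset.sum_const, Finset.card_univ, Fintype.card_prod, Fintype.card_fin, hexp, nsmul_eq_mul]
  push_cast
  refine le_of_eq ?_
  field_simp

end Rate

end HyperCov

/-! ### Assembly of the rate, uniformly in k. -/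

theorem mainTheorem8 (τβ τε : ℝ≥0) (γ₀ c₀ : ℝ) (hγ₀ : 0 < γ₀) (hc₀ : 0 < c₀) :
    ∃ C₀ : ℝ, 0 < C₀ ∧
      ∀ (κ : ℝ), 0 < κ →
      ∀ (p L s : ℕ → ℕ) (n : ∀ k, Fin (L k) → ℕ)
        (X : ∀ k, ∀ ℓ : Fin (L k), Matrix (Fin (n k ℓ)) (Fin (p k)) ℝ)
        (Ω : ∀ k, Matrix (Fin (p k)) (Fin (p k)) ℝ) (σ : ℝ)
        (S : ℕ → Type*) [∀ k, MeasurableSpace (S k)]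
        (μ : ∀ k, Measure (S k)) [∀ k, IsProbabilityMeasure (μ k)]
        (β : ∀ k, Fin (L k) → S k → Fin (p k) → ℝ)
        (ε : ∀ k, ∀ ℓ : Fin (L k), S k → Fin (n k ℓ) → ℝ)
        (lam : ℕ → ℝ) (Ωhat : ∀ k, S k → Matrix (Fin (p k)) (Fin (p k)) ℝ),
        (∀ k, 2 ≤ p k) → (∀ k, 1 ≤ L k) →
        Tendsto p atTop atTop →
        Tendsto (fun k => Real.log (p k) / (L k : ℝ)) atTop (𝓝 0) →
        (∀ k, HyperCov.IsFixedDesign (X k) γ₀ c₀ κ) →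
        (∀ k, HyperCov.IsRandomEffects (μ k) (β k) (ε k) (Ω k) σ τβ τε) →
        (∀ k, (HyperCov.offDiagSupport (Ω k)).ncard ≤ s k) →
        (∃ c₁ c₂ : ℝ, C₀ ≤ c₁ ∧ ∀ k, c₁ * √(Real.log (p k) / (L k : ℝ)) ≤ lam k ∧
          lam k ≤ c₂ * √(Real.log (p k) / (L k : ℝ))) →
        (∀ k, ∀ᵐ ω ∂(μ k), HyperCov.IsPenalizedMinimizer (X k)
          (fun ℓ => HyperCov.response (X k ℓ) (β k ℓ ω) (ε k ℓ ω)) σ (lam k) (Ωhat k ω)) →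
        HyperCov.IsBigOP μ (fun k ω => ‖Ωhat k ω - Ω k‖)
          (fun k => √(((p k : ℝ) + (s k : ℝ)) * Real.log (p k) / (L k : ℝ))) := by
  have hV : (0 : ℝ) < HyperCov.proxy τβ τε γ₀ c₀ := HyperCov.proxy_pos τβ τε γ₀ c₀
  obtain ⟨θ, hθ⟩ : ∃ θ : ℝ, θ = 3 / (8 * HyperCov.proxy τβ τε γ₀ c₀) := ⟨_, rfl⟩
  have hθ0 : 0 < θ := by rw [hθ]; positivity
  refine ⟨32 / θ, by positivity, ?_⟩
  intro κ hκ p L s n X Ω σ S _ μ _ β ε lam Ωhat hp hL hptop hlog hX hR hs hlam hmin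
  obtain ⟨c₁, c₂, hc₁, hlam⟩ := hlam
  have hp0 : ∀ k, 0 < p k := fun k => lt_of_lt_of_le (by norm_num) (hp k)
  have hL' : ∀ k, (0 : ℝ) < L k := fun k => by exact_mod_cast hL k
  have hlogpos : ∀ k, 0 < Real.log (p k) := fun k =>
    Real.log_pos (by exact_mod_cast lt_of_lt_of_le one_lt_two (hp k))
  have hΩ : ∀ k, (Ω k).PosSemidef := fun k => (hR k).posSemidef (hp0 k) ⟨0, hL k⟩
  have hlow : ∀ k, 32 / θ * √(Real.log (p k) / (L k : ℝ)) ≤ lam k := fun k =>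
    (mul_le_mul_of_nonneg_right hc₁ (Real.sqrt_nonneg _)).trans (hlam k).1
  have hlam0 : ∀ k, 0 ≤ lam k := fun k => le_trans (by positivity) (hlow k)
  have hb : ∀ k, 0 < √(((p k : ℝ) + (s k : ℝ)) * Real.log (p k) / (L k : ℝ)) := fun k => by
    have h1 := hlogpos k
    have h2 := hL' k
    have h3 : (0 : ℝ) < p k := by exact_mod_cast hp0 k
    positivity
  have hscore : ∀ k, Measurable fun ω => ∑ i, ∑ j, (|2 / (L k : ℝ) * ∑ ℓ,
      HyperCov.score (X k ℓ) (HyperCov.response (X k ℓ) (β k ℓ ω) (ε k ℓ ω)) (Ω k) σ i j|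
        + lam k) := fun k => by
    refine Finset.measurable_fun_sum _ fun i _ => Finset.measurable_fun_sum _ fun j _ => ?_
    refine Measurable.add_const (Measurable.abs (Measurable.const_mul ?_ _)) _
    exact Finset.measurable_fun_sum _ fun ℓ _ =>
      HyperCov.measurable_score_apply _ _ _ _ _ ((hR k).measurable_response ℓ)
  -- For a fixed index, the error has a measurable finite bound.
  have hfix : ∀ k, Tendsto (fun K : ℝ => μ k {ω | K < |‖Ωhat k ω - Ω k‖
      / √(((p k : ℝ) + (s k : ℝ)) * Real.log (p k) / (L k : ℝ))|}) atTop (𝓝 0) := fun k => by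
    refine tendsto_of_tendsto_of_tendsto_of_le_of_le tendsto_const_nhds
      (HyperCov.tendsto_measure_lt_atTop (μ k) (((hscore k).div_const κ).div_const
        (√(((p k : ℝ) + (s k : ℝ)) * Real.log (p k) / (L k : ℝ))))) (fun _ => zero_le) fun K => ?_
    refine measure_mono_ae ?_
    filter_upwards [hmin k] with ω hω hK
    have h1 := hω.norm_sub_le (hΩ k) (hX k) (hL k) (hlam0 k)
    refine lt_of_lt_of_le hK ?_
    rw [abs_of_nonneg (div_nonneg (norm_nonneg _) (hb k).le)]
    refine div_le_div_of_nonneg_right ?_ (hb k).le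
    rw [le_div_iff₀ hκ]
    linarith
  rw [HyperCov.IsBigOP, ENNReal.tendsto_nhds_zero]
  intro δ hδ
  have htail : Tendsto (fun k => ENNReal.ofReal (2 / (p k : ℝ) ^ 2)) atTop (𝓝 0) := by
    have h1 : Tendsto (fun k => (p k : ℝ) ^ 2) atTop atTop :=
      (tendsto_pow_atTop two_ne_zero).comp (tendsto_natCast_atTop_atTop.comp hptop)
    simpa using ENNReal.tendsto_ofReal (h1.const_div_atTop 2)
  -- The supremum runs over every k: beyond k₀ the score event decides, and below it finitely many
  -- individual limits in K are combined.
  obtain ⟨k₀, hk₀⟩ := eventually_atTop.1 ((hlog.eventually_le_const one_pos).and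
    (htail.eventually_le_const hδ))
  have hsmall : ∀ᶠ K : ℝ in atTop, ∀ k ∈ Finset.range k₀, μ k {ω | K < |‖Ωhat k ω - Ω k‖
      / √(((p k : ℝ) + (s k : ℝ)) * Real.log (p k) / (L k : ℝ))|} ≤ δ :=
    (Finset.range k₀).eventually_all.2 fun k _ => ENNReal.tendsto_nhds_zero.1 (hfix k) δ hδ
  -- On the good score event the error is at most 2c₂/κ times the rate, so exceeding K forces the
  -- bad event.
  filter_upwards [hsmall, eventually_ge_atTop (2 * c₂ / κ)] with K hK1 hK2
  refine iSup_le fun k => ?_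
  by_cases hk : k < k₀
  · exact hK1 k (Finset.mem_range.2 hk)
  obtain ⟨hlk, htk⟩ := hk₀ k (not_lt.1 hk)
  refine le_trans (measure_mono_ae ?_) (((hR k).measure_score_gt_le (hX k) hγ₀ hc₀ (hp k) (hL k)
    hθ hlk (hlow k)).trans htk)
  filter_upwards [hmin k] with ω hω hK
  by_contra hbad
  have hgood : ∀ i j, |2 / (L k : ℝ) * ∑ ℓ, HyperCov.score (X k ℓ)
      (HyperCov.response (X k ℓ) (β k ℓ ω) (ε k ℓ ω)) (Ω k) σ i j| ≤ lam k := fun i j =>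
    not_lt.1 fun hlt => hbad ⟨i, j, hlt⟩
  have h1 := hω.norm_sub_le_of_score_le (hΩ k) (hX k) (hL k) (hlam0 k) (hs k) hgood
  have h2 : κ * ‖Ωhat k ω - Ω k‖
      ≤ 2 * c₂ * √(((p k : ℝ) + (s k : ℝ)) * Real.log (p k) / (L k : ℝ)) := by
    rw [mul_div_assoc, Real.sqrt_mul (by positivity)]
    have h3 := mul_le_mul_of_nonneg_right (hlam k).2 (Real.sqrt_nonneg ((p k : ℝ) + (s k : ℝ)))
    linarith
  have h4 : K < ‖Ωhat k ω - Ω k‖ / √(((p k : ℝ) + (s k : ℝ)) * Real.log (p k) / (L k : ℝ)) := by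
    have h5 : K < |‖Ωhat k ω - Ω k‖
      / √(((p k : ℝ) + (s k : ℝ)) * Real.log (p k) / (L k : ℝ))| := hK
    rwa [abs_of_nonneg (div_nonneg (norm_nonneg _) (hb k).le)] at h5
  rw [lt_div_iff₀ (hb k)] at h4
  rw [div_le_iff₀ hκ] at hK2
  have h6 := mul_lt_mul_of_pos_left h4 hκ
  have h7 := mul_le_mul_of_nonneg_right hK2 (hb k).le
  linarith
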